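/- Conventions. A POVM with $r$ outcomes on a finite-dimensional Hilbert space is a family $E_1,\dots,E_r$ of positive semidefinite (PSD) operators with $E_1+\dots+E_r\le I$. For PSD operators $A_1,\dots,A_r$ put $P_e^*(A_1,\dots,A_r):=\min\{\sum_{i=1}^r \operatorname{Tr}A_i(I-E_i): (E_i)\text{ a POVM}\}$. Powers of PSD operators are taken on the support (so $A^0$ is the projection onto the support of $A$); $Q_{\min}(A,B):=\min_{0\le s\le1}\operatorname{Tr}A^sB^{1-s}$ and $C(A,B):=-\log Q_{\min}(A,B)$, with $\log 0:=-\infty$. For sequences $\vec A_i=\{A_{i,n}\}_{n\in\mathbb N}$ of PSD operators, where $A_{1,n},\dots,A_{r,n}$ act on a common finite-dimensional Hilbert space $\mathcal H_n$, put $$\underline p_e(\vec A_1,\dots,\vec A_r):=\liminf_{n\to\infty}\tfrac1n\log P_e^*(A_{1,n},\dots,A_{r,n}),\qquad \overline p_e(\vec A_1,\dots,\vec A_r):=\limsup_{n\to\infty}\tfrac1n\log P_e^*(A_{1,n},\dots,A_{r,n}),$$ and $C(\vec A_i,\vec A_j):=-\limsup_{n\to\infty}\frac1n\log Q_{\min}(A_{i,n},A_{j,n})$.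 All these exponents take values in $[-\infty,+\infty]$. Theorem. Let $r\ge2$. (1) Let $\vec A_1,\dots,\vec A_r$ be sequences of non-zero PSD operators as above, let $A_{0,n}:=\sum_{i=1}^rA_{i,n}$, and assume $\limsup_{n\to\infty}\frac1n\log\operatorname{Tr}A_{0,n}=0$. Then $$\overline p_e(\vec A_1,\dots,\vec A_r)\le\tfrac12\max_{i\ne j}\overline p_e(\vec A_i,\vec A_j)\le-\tfrac12\min_{i\ne j}C(\vec A_i,\vec A_j).$$ If, moreover, there are at least $r-2$ indices $i$ such that $A_{i,n}$ has rank one for every $n$, and $\limsup_{n\to\infty}\frac1n\log\frac{\operatorname{Tr}A_{0,n}}{\min_i\operatorname{Tr}A_{i,n}}=0$, then $$\overline p_e(\vec A_1,\dots,\vec A_r)\le\max_{i\ne j}\overline p_e(\vec A_i,\vec A_j)\le-\min_{i\ne j}C(\vec A_i,\vec A_j).$$ (2) In the i.i.d. case $A_{i,n}=p_i\sigma_i^{\otimes n}$, where $p_i>0$ and $\sigma_1,\dots,\sigma_r$ are density operators on a common finite-dimensional Hilbert space, $$-\min_{i\ne j}C(\sigma_i,\sigma_j)\le\underline p_e(\vec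 A_1,\dots,\vec A_r)\le\overline p_e(\vec A_1,\dots,\vec A_r)\le-\tfrac12\min_{i\ne j}C(\sigma_i,\sigma_j).$$ If at least $r-2$ of the $\sigma_i$ have rank one, then $$\underline p_e(\vec A_1,\dots,\vec A_r)=\overline p_e(\vec A_1,\dots,\vec A_r)=-\min_{i\ne j}C(\sigma_i,\sigma_j).$$ -/

import Mathlib

open scoped BigOperators Matrix ComplexOrder

noncomputable section

namespace StateDiscrimination

/-- `E` is a (possibly incomplete) POVM on `ℂ^d` with outcomes in `ι`:
`E i ≥ 0` for all `i`, and `∑ i, E i ≤ I`. -/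
def IsPOVM {ι d : Type*} [Fintype ι] [Fintype d] [DecidableEq d]
    (E : ι → Matrix d d ℂ) : Prop :=
  (∀ i, (E i).PosSemidef) ∧ (1 - ∑ i, E i).PosSemidef

/-- The error `∑ i, Tr A i (I - E i)` of the measurement `E` for the hypotheses `A`. -/
def povmError {ι d : Type*} [Fintype ι] [Fintype d] [DecidableEq d]
    (A E : ι → Matrix d d ℂ) : ℝ :=
  ∑ i, ((A i * (1 - E i)).trace).re

/-- The optimal error `P_e^*` of the hypotheses `A`: the minimum of the error over all POVMs.
(For positive semidefinite `A` the set below is non-empty and bounded below by `0`, and the infimum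
is attained because the set of POVMs is compact.) -/
def optError {ι d : Type*} [Fintype ι] [Fintype d] [DecidableEq d]
    (A : ι → Matrix d d ℂ) : ℝ :=
  sInf {e : ℝ | ∃ E : ι → Matrix d d ℂ, IsPOVM E ∧ e = povmError A E}

/-- The exponent `limsup (1/n) log P_e^*(A_{1,n}, …, A_{r,n})`, with `log 0 = -∞`
(`ExpGrowth.expGrowthSup u` is `limsup (log (u n) / n)`). -/
def upperExponent {ι : Type*} [Fintype ι] {d : ℕ → Type*} [∀ n, Fintype (d n)]
    [∀ n, DecidableEq (d n)] (A : ι → (n : ℕ) → Matrix (d n) (d n) ℂ) : EReal :=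
  ExpGrowth.expGrowthSup fun n => ENNReal.ofReal (optError fun i => A i n)

/-- The exponent `liminf (1/n) log P_e^*(A_{1,n}, …, A_{r,n})`, with `log 0 = -∞`. -/
def lowerExponent {ι : Type*} [Fintype ι] {d : ℕ → Type*} [∀ n, Fintype (d n)]
    [∀ n, DecidableEq (d n)] (A : ι → (n : ℕ) → Matrix (d n) (d n) ℂ) : EReal :=
  ExpGrowth.expGrowthInf fun n => ENNReal.ofReal (optError fun i => A i n)

/-- The real power `A ^ s` of a positive semidefinite matrix, taken on its support: if
`A = ∑ a • P_a` is the spectral decomposition, then `A ^ s = ∑ a ^ s • P_a` over the eigenvalues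
`a > 0`. In particular `A ^ 0` is the projection onto the support of `A`. -/
def supportPow {d : Type*} [Fintype d] [DecidableEq d] (A : Matrix d d ℂ) (s : ℝ) :
    Matrix d d ℂ :=
  cfc (fun x : ℝ => if 0 < x then x ^ s else 0) A

/-- `Q_s(A‖B) = Tr A^s B^(1-s)`. -/
def chernoffQ {d : Type*} [Fintype d] [DecidableEq d] (A B : Matrix d d ℂ) (s : ℝ) : ℝ :=
  ((supportPow A s * supportPow B (1 - s)).trace).re

/-- `Q_min(A, B) = min_{0 ≤ s ≤ 1} Q_s(A‖B)`; the minimum is attained, since `s ↦ Q_s(A‖B)` is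
continuous. -/
def chernoffQMin {d : Type*} [Fintype d] [DecidableEq d] (A B : Matrix d d ℂ) : ℝ :=
  sInf (chernoffQ A B '' Set.Icc 0 1)

/-- The Chernoff divergence `C(A, B) = -log Q_min(A, B)`, equal to `+∞` if `Q_min(A, B) = 0`. -/
def chernoffDiv {d : Type*} [Fintype d] [DecidableEq d] (A B : Matrix d d ℂ) : EReal :=
  -ENNReal.log (ENNReal.ofReal (chernoffQMin A B))

/-- The regularized Chernoff divergence of two sequences,
`-limsup (1/n) log Q_min(A_n, B_n)`. -/
def regChernoffDiv {d : ℕ → Type*} [∀ n, Fintype (d n)] [∀ n, DecidableEq (d n)]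
    (A B : (n : ℕ) → Matrix (d n) (d n) ℂ) : EReal :=
  -ExpGrowth.expGrowthSup fun n => ENNReal.ofReal (chernoffQMin (A n) (B n))

/-- A density matrix: positive semidefinite with unit trace. -/
def IsState {d : Type*} [Fintype d] (σ : Matrix d d ℂ) : Prop :=
  σ.PosSemidef ∧ σ.trace = 1

/-- The `n`-fold tensor power `σ^{⊗n}`, acting on `(ℂ^d)^{⊗n} = ℂ^(d^n)`. -/
def tensorPow {d : Type*} (σ : Matrix d d ℂ) (n : ℕ) : Matrix (Fin n → d) (Fin n → d) ℂ :=
  Matrix.of fun x y => ∏ k, σ (x k) (y k)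

/-- The i.i.d. hypothesis `n ↦ p σ^{⊗n}`. -/
def iidSeq {d : Type*} (p : ℝ) (σ : Matrix d d ℂ) (n : ℕ) :
    Matrix (Fin n → d) (Fin n → d) ℂ :=
  (p : ℂ) • tensorPow σ n

end StateDiscrimination

end

/-!
# Error exponents in multiple quantum state discrimination

**Upper bounds from tests.** A measurement with `r` outcomes is assembled from one-versus-rest tests
`0 ≤ T i ≤ 1`, each of which accepts `A i` and rejects the other `A j`. By the Hayashi–Nagaoka
inequality (`exists_hayashi_nagaoka`) the normalised family `S^(-1/2) T i S^(-1/2)`, with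
`S = ∑ i, T i`, has an error that is linear in the errors of the tests (`optError_le_of_tests`). It
remains to build one-versus-rest tests from tests `T i j` for pairs.

* In general, `T i = (1 + c ∑ j, (1 - T i j))⁻¹`. It fails on `A i` with weight at most
  `c ∑ j, Tr A i (1 - T i j)`, and it lies below `T i j + (1 - T i j) / (1 + c)` for each `j`, so that
  it accepts `A j` only with weight `Tr A j (T i j) + Tr A j / (1 + c)`. Balancing `c` gives a bound
  by the square root of the pairwise errors (`optError_le_sqrt_of_lt`), hence the factor `1 / 2` in
  the exponent.
* If all but two of the `A k` are multiples of projections `P k`, then the `P k` themselves are tests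
  for these `A k`, and the at most two other hypotheses are tested by `Q F Q`, where `F` is a test for
  the pair and `Q` is a smoothed projection onto the complement of the ranges of the `P k`. All errors
  are linear in the pairwise ones (`optError_le_mul_of_lt`), up to the ratio of the traces.

**Binary upper bound.** The optimal error of a pair is at most `Tr A ^ s B ^ (1 - s)` for every
`s ∈ [0, 1]` (`optError_pair_le_chernoffQ`), by operator monotonicity of fractional powers.

**Lower bound for i.i.d. hypotheses.** The optimal error of a subfamily is at most that of the family,
so a pair may be considered. In eigenbases of the two states, the binary quantum problem is bounded
below by a classical one (`half_sum_min_le_optError`), whose Chernoff sums are exactly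
`Tr A ^ s B ^ (1 - s)` (`chernoffQ_conj_diagonal`). Chernoff's classical lower bound
(`exists_classical_chernoff`) concludes.
-/

namespace StateDiscrimination

open scoped MatrixOrder Matrix.Norms.L2Operator
open Matrix Finset

lemma PosSemidef.of_eq {d : Type*} {A B : Matrix d d ℂ} (hA : A.PosSemidef) (h : A = B) :
    B.PosSemidef :=
  h ▸ hA

/-! ### Traces of products of positive semidefinite matrices -/

section TracePositivity

variable {d : Type*} [Fintype d]

lemma trace_mul_re_nonneg {A B : Matrix d d ℂ} (hA : A.PosSemidef) (hB : B.PosSemidef) :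
    0 ≤ ((A * B).trace).re := by
  classical
  obtain ⟨X, rfl⟩ := CStarAlgebra.nonneg_iff_eq_star_mul_self.mp hB.nonneg
  have h : (X * A * Xᴴ).PosSemidef := hA.mul_mul_conjTranspose_same X
  have h2 := (Complex.nonneg_iff.mp h.trace_nonneg).1
  rwa [Matrix.trace_mul_comm, ← Matrix.mul_assoc, Matrix.trace_mul_comm, star_eq_conjTranspose,
    ← Matrix.mul_assoc] at *

lemma trace_re_nonneg {A : Matrix d d ℂ} (hA : A.PosSemidef) : 0 ≤ (A.trace).re :=
  (Complex.nonneg_iff.mp hA.trace_nonneg).1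

lemma trace_mul_re_mono {A X Y : Matrix d d ℂ} (hA : A.PosSemidef) (h : X ≤ Y) :
    ((A * X).trace).re ≤ ((A * Y).trace).re := by
  have := trace_mul_re_nonneg hA (Matrix.le_iff.mp h)
  rw [Matrix.mul_sub, Matrix.trace_sub, Complex.sub_re] at this
  linarith

lemma PosSemidef.sandwich {A X : Matrix d d ℂ} (hA : A.PosSemidef) (hX : X.IsHermitian) :
    (X * A * X).PosSemidef := by
  simpa [hX.eq] using hA.mul_mul_conjTranspose_same X

lemma sq_le_self_of_le_one [DecidableEq d] {T : Matrix d d ℂ} (h0 : T.PosSemidef) (h1 : T ≤ 1) :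
    T * T ≤ T := by
  have h1' : (1 - T).PosSemidef := Matrix.le_iff.mp h1
  rw [Matrix.le_iff]
  have := (PosSemidef.sandwich h1' h0.1).add (PosSemidef.sandwich h0 h1'.1)
  refine PosSemidef.of_eq this ?_
  noncomm_ring

/-- The noncommutative form of `(x + y) ^ 2 ≤ 2 x ^ 2 + 2 y ^ 2`. -/
lemma add_mul_mul_add_le {N X Y : Matrix d d ℂ} (hN : N.PosSemidef)
    (hX : X.IsHermitian) (hY : Y.IsHermitian) :
    (X + Y) * N * (X + Y) ≤ (2 : ℝ) • (X * N * X) + (2 : ℝ) • (Y * N * Y) := by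
  rw [Matrix.le_iff]
  refine PosSemidef.of_eq (PosSemidef.sandwich hN (hX.sub hY)) ?_
  rw [two_smul, two_smul]
  noncomm_ring

end TracePositivity

/-! ### Measurements from one-versus-rest tests -/

section Measurements

variable {ι d : Type*} [Fintype ι] [Fintype d] [DecidableEq d]

lemma IsPOVM.le_one {E : ι → Matrix d d ℂ} (hE : IsPOVM E) (i : ι) : E i ≤ 1 := by
  refine le_trans ?_ (Matrix.le_iff.mpr hE.2)
  exact Finset.single_le_sum (f := E) (fun j _ => (hE.1 j).nonneg) (mem_univ i)

lemma povmError_nonneg {A E : ι → Matrix d d ℂ} (hA : ∀ i, (A i).PosSemidef) (hE : IsPOVM E) :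
    0 ≤ povmError A E :=
  sum_nonneg fun i _ => trace_mul_re_nonneg (hA i) (Matrix.le_iff.mp (hE.le_one i))

lemma optError_le {A E : ι → Matrix d d ℂ} (hA : ∀ i, (A i).PosSemidef) (hE : IsPOVM E) :
    optError A ≤ povmError A E :=
  csInf_le ⟨0, by rintro _ ⟨F, hF, rfl⟩; exact povmError_nonneg hA hF⟩ ⟨E, hE, rfl⟩

lemma isPOVM_zero : IsPOVM (fun _ : ι => (0 : Matrix d d ℂ)) :=
  ⟨fun _ => .zero, by simpa using Matrix.PosSemidef.one⟩

lemma le_optError {A : ι → Matrix d d ℂ} {x : ℝ} (h : ∀ E, IsPOVM E → x ≤ povmError A E) :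
    x ≤ optError A :=
  le_csInf ⟨_, _, isPOVM_zero, rfl⟩ (by rintro _ ⟨E, hE, rfl⟩; exact h E hE)

lemma optError_nonneg {A : ι → Matrix d d ℂ} (hA : ∀ i, (A i).PosSemidef) : 0 ≤ optError A :=
  le_optError fun _ hE => povmError_nonneg hA hE

lemma exists_povmError_lt {A : ι → Matrix d d ℂ} {ε : ℝ} (h : optError A < ε) :
    ∃ E, IsPOVM E ∧ povmError A E < ε := by
  by_contra! hc
  exact absurd (le_optError hc) (not_le.mpr h)

/-- A POVM with two outcomes can be completed by enlarging its second element: two hypotheses are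
discriminated by a single test `0 ≤ T ≤ 1`. -/
lemma exists_test_of_optError_lt {A B : Matrix d d ℂ} (hB : B.PosSemidef)
    {ε : ℝ} (h : optError ![A, B] < ε) :
    ∃ T : Matrix d d ℂ, T.PosSemidef ∧ T ≤ 1 ∧
      ((A * (1 - T)).trace).re + ((B * T).trace).re ≤ ε := by
  obtain ⟨E, hE, hlt⟩ := exists_povmError_lt h
  refine ⟨E 0, hE.1 0, hE.le_one 0, ?_⟩
  simp only [povmError, Fin.sum_univ_two, cons_val_zero, cons_val_one] at hlt
  have : E 0 ≤ 1 - E 1 := by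
    have := hE.2
    rw [Fin.sum_univ_two] at this
    rw [Matrix.le_iff]
    refine PosSemidef.of_eq this ?_
    abel
  linarith [trace_mul_re_mono hB this]

/-- The **Hayashi–Nagaoka inequality**: if `0 ≤ T ≤ 1`, `N ≥ 0` and `S = T + N` is invertible, then
`1 - S^(-1/2) T S^(-1/2) ≤ 2 (1 - T) + 4 N`. It is stated for a matrix `R` playing the role of
`S^(-1/2)`. -/
lemma exists_hayashi_nagaoka {S : Matrix d d ℂ} (hS : S.PosDef) :
    ∃ R : Matrix d d ℂ, R.IsHermitian ∧ R * S * R = 1 ∧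
      ∀ T : Matrix d d ℂ, T.PosSemidef → T ≤ 1 → T ≤ S →
        1 - R * T * R ≤ (2 : ℝ) • (1 - T) + (4 : ℝ) • (S - T) := by
  set Q := CFC.sqrt S with hQ
  have hQQ : Q * Q = S := CFC.sqrt_mul_sqrt_self S hS.posSemidef.nonneg
  have hQpos : Q.PosSemidef := (CFC.sqrt_nonneg S).posSemidef
  have hdet : IsUnit Q.det := by
    have h1 : IsUnit S.det := (Matrix.isUnit_iff_isUnit_det S).mp hS.isUnit
    rw [← hQQ, Matrix.det_mul] at h1
    exact isUnit_of_mul_isUnit_left h1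
  have hRQ : Q⁻¹ * Q = 1 := Matrix.nonsing_inv_mul Q hdet
  have hQR : Q * Q⁻¹ = 1 := Matrix.mul_nonsing_inv Q hdet
  have hR : Q⁻¹.IsHermitian := hQpos.1.inv
  have hRSR : Q⁻¹ * S * Q⁻¹ = 1 := by
    rw [← hQQ, ← Matrix.mul_assoc, hRQ, Matrix.one_mul, hQR]
  refine ⟨Q⁻¹, hR, hRSR, fun T h0 h1 hTS => ?_⟩
  have hTQ : T ≤ Q := by
    have h2 : CFC.sqrt (T * T) ≤ CFC.sqrt S :=
      CFC.sqrt_le_sqrt _ _ ((sq_le_self_of_le_one h0 h1).trans hTS)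
    rwa [CFC.sqrt_mul_self T h0.nonneg] at h2
  have hN : (S - T).PosSemidef := Matrix.le_iff.mp hTS
  set R := Q⁻¹ with hRdef
  have hX : (R - 1).IsHermitian := hR.sub Matrix.isHermitian_one
  have e1 : 1 - R * T * R = (1 + (R - 1)) * (S - T) * (1 + (R - 1)) := by
    rw [← hRSR]; noncomm_ring
  have e2 : (R - 1) * S * (R - 1) = 1 - (2 : ℝ) • Q + S := by
    have a1 : R * S = Q := by rw [← hQQ, ← Matrix.mul_assoc, hRQ, Matrix.one_mul]
    have a2 : S * R = Q := by rw [← hQQ, Matrix.mul_assoc, hQR, Matrix.mul_one]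
    have : (R - 1) * S * (R - 1) = R * S * R - R * S - S * R + S := by noncomm_ring
    rw [this, hRSR, a1, a2, two_smul]
    abel
  have e3 : (R - 1) * (S - T) * (R - 1) ≤ (R - 1) * S * (R - 1) := by
    rw [Matrix.le_iff]
    refine PosSemidef.of_eq (PosSemidef.sandwich h0 hX) ?_
    noncomm_ring
  have e4 := add_mul_mul_add_le hN Matrix.isHermitian_one hX
  rw [Matrix.one_mul, Matrix.mul_one] at e4
  rw [e1]
  refine e4.trans ?_
  have e5 : (2 : ℝ) • ((R - 1) * (S - T) * (R - 1)) ≤ (2 : ℝ) • (1 - (2 : ℝ) • T + S) := by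
    refine smul_le_smul_of_nonneg_left (e3.trans ?_) (by norm_num)
    rw [e2]
    gcongr
  refine (add_le_add_right e5 _).trans (le_of_eq ?_)
  module

/-- Tests `T i` that accept `A i` and reject the other `A j` combine to a measurement whose error is
controlled linearly by the errors of these one-versus-rest tests. -/
theorem optError_le_of_tests [DecidableEq ι] {A T : ι → Matrix d d ℂ}
    (hA : ∀ i, (A i).PosSemidef)
    (h0 : ∀ i, (T i).PosSemidef) (h1 : ∀ i, T i ≤ 1) :
    optError A ≤ 2 * ∑ i, ((A i * (1 - T i)).trace).re +
      4 * ∑ i, ∑ j ∈ univ.erase i, ((A i * T j).trace).re := by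
  have key : ∀ δ : ℝ, 0 < δ → optError A ≤ 2 * ∑ i, ((A i * (1 - T i)).trace).re +
      4 * ∑ i, ∑ j ∈ univ.erase i, ((A i * T j).trace).re + δ * (4 * ∑ i, ((A i).trace).re) := by
    intro δ hδ
    have hTsum : (∑ i, T i).PosSemidef := Matrix.posSemidef_sum _ fun i _ => h0 i
    have hδ1 : (δ • (1 : Matrix d d ℂ)).PosDef := Matrix.PosDef.one.smul hδ
    have hS : (∑ i, T i + δ • (1 : Matrix d d ℂ)).PosDef := hδ1.posSemidef_add hTsum
    obtain ⟨R, hR, hRSR, hHN⟩ := exists_hayashi_nagaoka hS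
    have hTS : ∀ i, T i ≤ ∑ i, T i + δ • (1 : Matrix d d ℂ) := fun i =>
      (Finset.single_le_sum (f := T) (fun j _ => (h0 j).nonneg) (mem_univ i)).trans
        (le_add_of_nonneg_right hδ1.posSemidef.nonneg)
    have hE : IsPOVM (fun i => R * T i * R) := by
      refine ⟨fun i => PosSemidef.sandwich (h0 i) hR, ?_⟩
      have := PosSemidef.sandwich hδ1.posSemidef hR
      refine PosSemidef.of_eq this ?_
      rw [← Finset.sum_mul, ← Finset.mul_sum, eq_sub_iff_add_eq]
      refine Eq.trans ?_ hRSR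
      noncomm_ring
    refine (optError_le hA hE).trans ?_
    have hterm : ∀ i, ((A i * (1 - R * T i * R)).trace).re ≤
        2 * ((A i * (1 - T i)).trace).re + 4 * ∑ j ∈ univ.erase i, ((A i * T j).trace).re
          + δ * (4 * ((A i).trace).re) := by
      intro i
      refine (trace_mul_re_mono (hA i) (hHN (T i) (h0 i) (h1 i) (hTS i))).trans (le_of_eq ?_)
      have : ∑ j, T j + δ • (1 : Matrix d d ℂ) - T i = ∑ j ∈ univ.erase i, T j + δ • 1 := by
        rw [← Finset.add_sum_erase _ _ (mem_univ i)]; abel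
      rw [this]
      simp only [Matrix.mul_add, Matrix.mul_smul, Matrix.trace_add, Matrix.trace_smul,
        Complex.add_re, Complex.smul_re, Matrix.mul_sum, Matrix.trace_sum, Complex.re_sum,
        smul_eq_mul, Matrix.mul_one]
      ring
    refine (Finset.sum_le_sum fun i _ => hterm i).trans (le_of_eq ?_)
    simp only [Finset.sum_add_distrib, Finset.mul_sum]
  -- let `δ → 0`
  have hc : Filter.Tendsto (fun δ : ℝ => 2 * ∑ i, ((A i * (1 - T i)).trace).re +
      4 * ∑ i, ∑ j ∈ univ.erase i, ((A i * T j).trace).re + δ * (4 * ∑ i, ((A i).trace).re))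
      (nhdsWithin 0 (Set.Ioi 0)) (nhds (2 * ∑ i, ((A i * (1 - T i)).trace).re +
      4 * ∑ i, ∑ j ∈ univ.erase i, ((A i * T j).trace).re + 0 * (4 * ∑ i, ((A i).trace).re))) :=
    (Continuous.tendsto (by fun_prop) 0).mono_left nhdsWithin_le_nhds
  rw [zero_mul, add_zero] at hc
  exact ge_of_tendsto hc (by filter_upwards [self_mem_nhdsWithin] with δ hδ using key δ hδ)

end Measurements

lemma posDef_one_add {d : Type*} [DecidableEq d] {K : Matrix d d ℂ} (hK : K.PosSemidef) :
    (1 + K).PosDef :=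
  Matrix.PosDef.one.add_posSemidef hK

/-! ### Resolvent inequalities -/

section Resolvent

variable {d : Type*} [Fintype d] [DecidableEq d]

lemma inv_le_inv_of_le {X Y : Matrix d d ℂ} (hY : Y.PosDef) (hX : X.PosDef) (h : Y ≤ X) :
    X⁻¹ ≤ Y⁻¹ := by
  have := CStarAlgebra.inv_le_inv (a := hY.isUnit.unit) (b := hX.isUnit.unit)
    hY.posSemidef.nonneg h
  rwa [Matrix.coe_units_inv, Matrix.coe_units_inv] at this

lemma inv_one_add_le_one {K : Matrix d d ℂ} (hK : K.PosSemidef) : (1 + K)⁻¹ ≤ 1 := by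
  simpa using inv_le_inv_of_le Matrix.PosDef.one (posDef_one_add hK)
    (le_add_of_nonneg_right hK.nonneg)

lemma one_sub_inv_one_add_le {K : Matrix d d ℂ} (hK : K.PosSemidef) : 1 - (1 + K)⁻¹ ≤ K := by
  have hX := posDef_one_add hK
  have hdet : IsUnit (1 + K).det := (Matrix.isUnit_iff_isUnit_det _).mp hX.isUnit
  have h1 := Matrix.nonsing_inv_mul _ hdet
  have h2 := Matrix.mul_nonsing_inv _ hdet
  rw [Matrix.le_iff]
  refine PosSemidef.of_eq (PosSemidef.sandwich hX.inv.posSemidef hK.1) ?_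
  set Y := (1 + K)⁻¹
  have h3 : Y * K = 1 - Y := by rw [← h1]; noncomm_ring
  have h4 : K * Y = 1 - Y := by rw [← h2]; noncomm_ring
  rw [Matrix.mul_assoc, h3, Matrix.mul_sub, h4]
  noncomm_ring

/-- The resolvent `(1 + c (1 - T))⁻¹` lies below the chord of `t ↦ 1 / (1 + c (1 - t))` between
`t = 0` and `t = 1`. -/
lemma inv_one_add_smul_le {T : Matrix d d ℂ} (h0 : T.PosSemidef) (h1 : T ≤ 1) {c : ℝ}
    (hc : 0 ≤ c) : (1 + c • (1 - T))⁻¹ ≤ T + (1 / (1 + c)) • (1 - T) := by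
  have hD : (1 - T).PosSemidef := Matrix.le_iff.mp h1
  have hY := posDef_one_add (hD.smul hc)
  have hdet : IsUnit (1 + c • (1 - T)).det := (Matrix.isUnit_iff_isUnit_det _).mp hY.isUnit
  have h1 := Matrix.nonsing_inv_mul _ hdet
  have h2 := Matrix.mul_nonsing_inv _ hdet
  have hTT : (T * (1 - T)).PosSemidef := by
    refine PosSemidef.of_eq ((PosSemidef.sandwich hD h0.1).add (PosSemidef.sandwich h0 hD.1)) ?_
    noncomm_ring
  have hPos : ((c ^ 2 / (1 + c)) • (T * (1 - T) + c • ((1 - T) * T * (1 - T)))).PosSemidef :=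
    (hTT.add ((PosSemidef.sandwich h0 hD.1).smul hc)).smul (by positivity)
  rw [Matrix.le_iff]
  refine PosSemidef.of_eq (PosSemidef.sandwich hPos hY.inv.1) ?_
  set Y := 1 + c • (1 - T) with hYdef
  have key : (c ^ 2 / (1 + c)) • (T * (1 - T) + c • ((1 - T) * T * (1 - T)))
      = Y * (T + (1 / (1 + c)) • (1 - T)) * Y - Y := by
    have hc' : (1 + c) ≠ 0 := by positivity
    simp only [hYdef, Matrix.add_mul, Matrix.mul_add, Matrix.smul_mul, Matrix.mul_smul, smul_add,
      Matrix.sub_mul, Matrix.mul_sub, smul_sub, Matrix.one_mul, Matrix.mul_one, smul_smul,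
      Matrix.mul_assoc]
    match_scalars <;> field_simp <;> ring
  rw [key, Matrix.mul_sub, h1, Matrix.sub_mul, Matrix.mul_assoc, Matrix.mul_assoc, Matrix.mul_assoc,
    h2, ← Matrix.mul_assoc, h1]
  simp

end Resolvent

/-! ### The square-root bound for general hypotheses -/

section SquareRootBound

lemma optError_le_trace {ι d : Type*} [Fintype ι] [Fintype d] [DecidableEq d]
    {A : ι → Matrix d d ℂ} (hA : ∀ i, (A i).PosSemidef) :
    optError A ≤ ((∑ i, A i).trace).re := by
  refine (optError_le hA isPOVM_zero).trans (le_of_eq ?_)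
  simp [povmError, Matrix.trace_sum]

lemma trace_le_trace_sum {ι d : Type*} [Fintype ι] [Fintype d] {A : ι → Matrix d d ℂ}
    (hA : ∀ i, (A i).PosSemidef) (i : ι) :
    ((A i).trace).re ≤ ((∑ i, A i).trace).re := by
  rw [Matrix.trace_sum, Complex.re_sum]
  exact Finset.single_le_sum (f := fun i => ((A i).trace).re)
    (fun j _ => trace_re_nonneg (hA j)) (mem_univ i)

variable {ι d : Type*} [Fintype ι] [DecidableEq ι] [Fintype d] [DecidableEq d]

/-- If every pair of hypotheses can be discriminated with error less than `ε`, by a test `T i j`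
say, then the harmonic-mean tests `(1 + c ∑ j, (1 - T i j))⁻¹` discriminate each `A i` from all the
others; the parameter `c = (Tr A₀ / ε) ^ (1 / 2)` balances the two kinds of error. -/
theorem optError_le_sqrt_of_lt {A : ι → Matrix d d ℂ} (hA : ∀ i, (A i).PosSemidef)
    {ε : ℝ} (hε : 0 < ε) (h : ∀ i j, i ≠ j → optError ![A i, A j] < ε) :
    optError A ≤ 10 * (Fintype.card ι : ℝ) ^ 2 * √(ε * ((∑ i, A i).trace).re) := by
  set t := ((∑ i, A i).trace).re with ht
  set r : ℝ := (Fintype.card ι : ℝ) with hr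
  have ht0 : 0 ≤ t := trace_re_nonneg (Matrix.posSemidef_sum _ fun i _ => hA i)
  rcases isEmpty_or_nonempty ι with hι | hι
  · have := optError_le hA (isPOVM_zero (ι := ι))
    simp only [povmError, univ_eq_empty, sum_empty] at this
    exact this.trans (by positivity)
  have hr1 : 1 ≤ r := by rw [hr]; exact_mod_cast Fintype.card_pos
  rcases le_total t ε with hle | hle
  · have h1 : t ≤ √(ε * t) := Real.le_sqrt_of_sq_le (by nlinarith)
    have h2 : 1 ≤ 10 * r ^ 2 := by nlinarith
    calc optError A ≤ t := optError_le_trace hA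
      _ ≤ √(ε * t) := h1
      _ ≤ _ := le_mul_of_one_le_left (Real.sqrt_nonneg _) h2
  have htpos : 0 < t := hε.trans_le hle
  choose! T hT0 hT1 hTε using fun i j (hij : i ≠ j) => exists_test_of_optError_lt (hA j) (h i j hij)
  set c := √(t / ε) with hc
  have hc0 : 0 < c := Real.sqrt_pos.mpr (by positivity)
  have hcε : c * ε = √(ε * t) := by
    rw [eq_comm, Real.sqrt_eq_iff_mul_self_eq (by positivity) (by positivity)]
    have : c * c = t / ε := Real.mul_self_sqrt (by positivity)
    symm
    calc c * ε * (c * ε) = (c * c) * ε ^ 2 := by ring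
      _ = ε * t := by rw [this]; field_simp
  have hct : t / c = √(ε * t) := by
    rw [← hcε, div_eq_iff hc0.ne']
    have : c * c = t / ε := Real.mul_self_sqrt (by positivity)
    calc t = (t / ε) * ε := by field_simp
      _ = c * ε * c := by rw [← this]; ring
  have hεs : ε ≤ √(ε * t) := Real.le_sqrt_of_sq_le (by nlinarith)
  have hD : ∀ i j, i ≠ j → (1 - T i j).PosSemidef := fun i j hij => Matrix.le_iff.mp (hT1 i j hij)
  have hK : ∀ i, (c • ∑ j ∈ univ.erase i, (1 - T i j)).PosSemidef := fun i =>
    (Matrix.posSemidef_sum _ fun j hj => hD i j (ne_of_mem_erase hj).symm).smul hc0.le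
  have hTA : ∀ i j, i ≠ j → 0 ≤ ((A j * T i j).trace).re := fun i j hij =>
    trace_mul_re_nonneg (hA j) (hT0 i j hij)
  have hDA : ∀ i j, i ≠ j → 0 ≤ ((A i * (1 - T i j)).trace).re := fun i j hij =>
    trace_mul_re_nonneg (hA i) (hD i j hij)
  -- the error of the first kind of each one-versus-rest test
  have first : ∀ i, ((A i * (1 - (1 + c • ∑ j ∈ univ.erase i, (1 - T i j))⁻¹)).trace).re
      ≤ r * √(ε * t) := by
    intro i
    refine (trace_mul_re_mono (hA i) (one_sub_inv_one_add_le (hK i))).trans ?_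
    rw [Matrix.mul_smul, Matrix.trace_smul, Complex.smul_re, Matrix.mul_sum, Matrix.trace_sum,
      Complex.re_sum, smul_eq_mul]
    calc c * ∑ j ∈ univ.erase i, ((A i * (1 - T i j)).trace).re
        ≤ c * ∑ j ∈ univ.erase i, ε := by
          gcongr with j hj
          have hij := (ne_of_mem_erase hj).symm
          linarith [hTε i j hij, hTA i j hij]
      _ ≤ c * (r * ε) := by
          rw [sum_const, nsmul_eq_mul]
          gcongr
          rw [hr, ← Finset.card_univ]
          exact_mod_cast card_le_card (erase_subset _ _)
      _ = r * √(ε * t) := by rw [← hcε]; ring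
  -- the error of the second kind
  have second : ∀ i j, i ≠ j →
      ((A i * (1 + c • ∑ k ∈ univ.erase j, (1 - T j k))⁻¹).trace).re ≤ 2 * √(ε * t) := by
    intro i j hij
    have hji := hij.symm
    have hmono : 1 + c • (1 - T j i) ≤ 1 + c • ∑ k ∈ univ.erase j, (1 - T j k) := by
      gcongr
      exact Finset.single_le_sum (f := fun k => 1 - T j k)
        (fun k hk => (hD j k (ne_of_mem_erase hk).symm).nonneg) (mem_erase.mpr ⟨hij, mem_univ i⟩)
    have h1 := (inv_le_inv_of_le (posDef_one_add ((hD j i hji).smul hc0.le))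
      (posDef_one_add (hK j)) hmono).trans (inv_one_add_smul_le (hT0 j i hji) (hT1 j i hji) hc0.le)
    refine (trace_mul_re_mono (hA i) h1).trans ?_
    rw [Matrix.mul_add, Matrix.trace_add, Matrix.mul_smul, Matrix.trace_smul, Complex.add_re,
      Complex.smul_re, smul_eq_mul]
    have h2 : ((A i * T j i).trace).re ≤ ε := by linarith [hTε j i hji, hDA j i hji]
    have h3 : ((A i * (1 - T j i)).trace).re ≤ t := by
      rw [Matrix.mul_sub, Matrix.mul_one, Matrix.trace_sub, Complex.sub_re]
      linarith [hTA j i hji, trace_le_trace_sum hA i]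
    have h4 : 1 / (1 + c) * ((A i * (1 - T j i)).trace).re ≤ t / c := by
      rw [div_mul_eq_mul_div, one_mul]
      gcongr
      linarith
    linarith
  have := optError_le_of_tests hA (T := fun i => (1 + c • ∑ j ∈ univ.erase i, (1 - T i j))⁻¹)
    (fun i => (posDef_one_add (hK i)).inv.posSemidef) (fun i => inv_one_add_le_one (hK i))
  refine this.trans ?_
  have s1 := Finset.sum_le_sum (s := univ) fun i _ => first i
  have s2 := Finset.sum_le_sum (s := univ) fun i _ =>
    (Finset.sum_le_sum fun j (hj : j ∈ univ.erase i) => second i j (ne_of_mem_erase hj).symm).trans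
      ((by
        rw [sum_const, nsmul_eq_mul]
        gcongr
        rw [hr, ← Finset.card_univ]
        exact_mod_cast card_le_card (erase_subset _ _)) :
          ∑ j ∈ univ.erase i, 2 * √(ε * t) ≤ r * (2 * √(ε * t)))
  rw [sum_const, nsmul_eq_mul, card_univ, ← hr] at s1 s2
  nlinarith

end SquareRootBound

/-! ### Projections and overlaps -/

section RankOne

variable {d : Type*} [Fintype d] [DecidableEq d]

lemma le_trace_smul_one {A : Matrix d d ℂ} (hA : A.PosSemidef) : A ≤ (A.trace).re • 1 := by
  rw [← Algebra.algebraMap_eq_smul_one]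
  refine le_algebraMap_of_spectrum_le (fun x hx => ?_) hA.1
  rw [hA.1.spectrum_real_eq_range_eigenvalues] at hx
  obtain ⟨i, rfl⟩ := hx
  rw [hA.1.trace_eq_sum_eigenvalues, Complex.re_sum]
  exact Finset.single_le_sum (f := fun i => ((hA.1.eigenvalues i : ℂ)).re)
    (fun j _ => by simpa using hA.eigenvalues_nonneg j) (mem_univ i)

lemma trace_mul_re_le {A B : Matrix d d ℂ} (hA : A.PosSemidef) (hB : B.PosSemidef) :
    ((A * B).trace).re ≤ (A.trace).re * (B.trace).re := by
  refine (trace_mul_re_mono hA (le_trace_smul_one hB)).trans (le_of_eq ?_)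
  simp [mul_comm]

lemma mul_self_eq_trace_smul_of_rank_eq_one {A : Matrix d d ℂ} (hA : A.PosSemidef)
    (h : A.rank = 1) : A * A = (A.trace).re • A := by
  have hH := hA.1
  rw [hH.rank_eq_card_non_zero_eigs, Fintype.card_eq_one_iff] at h
  obtain ⟨⟨i₀, hi₀⟩, huniq⟩ := h
  have hz : ∀ i, i ≠ i₀ → hH.eigenvalues i = 0 := by
    intro i hi
    by_contra hne
    exact hi (congrArg Subtype.val (huniq ⟨i, hne⟩))
  have htr : (A.trace).re = hH.eigenvalues i₀ := by
    rw [hH.trace_eq_sum_eigenvalues, Finset.sum_eq_single i₀ (fun i _ hi => by simp [hz i hi])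
      (by simp)]
    simp
  have hcfc : A * A = cfc (fun x : ℝ => x * x) A := by
    rw [cfc_mul (fun x : ℝ => x) (fun x : ℝ => x) A, cfc_id' ℝ A]
  have hcfc2 : (A.trace).re • A = cfc (fun x : ℝ => (A.trace).re * x) A := by
    rw [cfc_const_mul (A.trace).re (fun x : ℝ => x) A, cfc_id' ℝ A]
  rw [hcfc, hcfc2]
  refine cfc_congr fun x hx => ?_
  rw [hH.spectrum_real_eq_range_eigenvalues] at hx
  obtain ⟨i, rfl⟩ := hx
  by_cases hi : i = i₀
  · subst hi; simp [htr]
  · simp [hz i hi]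

lemma trace_re_pos {A : Matrix d d ℂ} (hA : A.PosSemidef) (h : A ≠ 0) : 0 < (A.trace).re := by
  refine lt_of_le_of_ne (trace_re_nonneg hA) fun h0 => h ?_
  have := le_trace_smul_one hA
  rw [← h0, zero_smul] at this
  exact le_antisymm this hA.nonneg

lemma proj_le_one {P : Matrix d d ℂ} (hP : P.PosSemidef) (hPP : P * P = P) : P ≤ 1 := by
  rw [Matrix.le_iff]
  refine PosSemidef.of_eq (PosSemidef.sandwich Matrix.PosSemidef.one
    (Matrix.isHermitian_one.sub hP.1)) ?_
  rw [Matrix.mul_one, Matrix.sub_mul, Matrix.mul_sub, Matrix.mul_sub, hPP]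
  simp

/-- If a test `T` discriminates `A` from a multiple `b P` of a projection, then `A` has a small
overlap with `P`. -/
lemma trace_mul_proj_le {A P T : Matrix d d ℂ} (hA : A.PosSemidef) (hP : P.PosSemidef)
    (hPP : P * P = P) (h0 : T.PosSemidef) (h1 : T ≤ 1) {b ε : ℝ} (hb : 0 < b)
    (h : ((b • P * (1 - T)).trace).re + ((A * T).trace).re ≤ ε) :
    ((A * P).trace).re ≤ 2 * ε + 2 * ((A.trace).re / b * ε) := by
  have hD : (1 - T).PosSemidef := Matrix.le_iff.mp h1
  have hD1 : 1 - T ≤ 1 := by simpa using h0.nonneg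
  have hP1 := proj_le_one hP hPP
  have e : P ≤ (2 : ℝ) • (T * P * T) + (2 : ℝ) • ((1 - T) * P * (1 - T)) := by
    simpa using add_mul_mul_add_le hP h0.1 hD.1
  have e1 : T * P * T ≤ T := by
    refine le_trans ?_ (sq_le_self_of_le_one h0 h1)
    rw [Matrix.le_iff]
    refine PosSemidef.of_eq (PosSemidef.sandwich (Matrix.le_iff.mp hP1) h0.1) ?_
    noncomm_ring
  have e2 : (((1 - T) * P * (1 - T)).trace).re ≤ ((P * (1 - T)).trace).re := by
    rw [Matrix.trace_mul_comm, ← Matrix.mul_assoc, Matrix.trace_mul_comm]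
    exact trace_mul_re_mono hP (sq_le_self_of_le_one hD hD1)
  have n1 : 0 ≤ ((P * (1 - T)).trace).re := trace_mul_re_nonneg hP hD
  have n2 : 0 ≤ ((A * T).trace).re := trace_mul_re_nonneg hA h0
  rw [Matrix.smul_mul, Matrix.trace_smul, Complex.smul_re, smul_eq_mul] at h
  have n3 : 0 ≤ b * ((P * (1 - T)).trace).re := by positivity
  have e3 : ((P * (1 - T)).trace).re ≤ ε / b := by
    rw [le_div_iff₀ hb]; linarith
  have e4 := trace_mul_re_le hA (PosSemidef.sandwich hP hD.1)
  have e5 := trace_mul_re_mono hA e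
  rw [Matrix.mul_add, Matrix.trace_add, Matrix.mul_smul, Matrix.mul_smul, Matrix.trace_smul,
    Matrix.trace_smul, Complex.add_re, Complex.smul_re, Complex.smul_re, smul_eq_mul,
    smul_eq_mul] at e5
  have e6 := trace_mul_re_mono hA e1
  have e7 : (A.trace).re * (((1 - T) * P * (1 - T)).trace).re ≤ (A.trace).re * (ε / b) :=
    mul_le_mul_of_nonneg_left (e2.trans e3) (trace_re_nonneg hA)
  have e8 : (A.trace).re / b * ε = (A.trace).re * (ε / b) := by ring
  rw [e8]
  linarith

/-- A smoothed version `Q = max (1 - 2 G) 0` of the projection onto the complement of the span of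
the vectors whose projections sum to `G`. -/
lemma exists_smooth_complement {G : Matrix d d ℂ} (hG : G.PosSemidef) :
    ∃ Q : Matrix d d ℂ, Q.PosSemidef ∧ Q ≤ 1 ∧ 1 - Q ≤ (2 : ℝ) • G ∧ Q ≤ (1 - G) * (1 - G) := by
  have hsa : IsSelfAdjoint G := hG.1
  have hspec : ∀ x ∈ spectrum ℝ G, 0 ≤ x := fun x hx => by
    rw [hG.1.spectrum_real_eq_range_eigenvalues] at hx
    obtain ⟨i, rfl⟩ := hx
    exact hG.eigenvalues_nonneg i
  refine ⟨cfc (fun x : ℝ => max (1 - 2 * x) 0) G, ?_, ?_, ?_, ?_⟩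
  · exact (cfc_nonneg fun x _ => le_max_right _ _).posSemidef
  · exact cfc_le_one _ _ fun x hx => max_le (by linarith [hspec x hx]) zero_le_one
  · have h1 : (1 : Matrix d d ℂ) - (2 : ℝ) • G = cfc (fun x : ℝ => 1 - 2 * x) G := by
      rw [cfc_sub (fun _ : ℝ => (1 : ℝ)) (fun x : ℝ => 2 * x) G, cfc_const_one ℝ G,
        cfc_const_mul (2 : ℝ) (fun x : ℝ => x) G, cfc_id' ℝ G]
    rw [sub_le_comm, h1]
    exact cfc_mono fun x _ => le_max_left _ _
  · have h1 : (1 - G) * (1 - G) = cfc (fun x : ℝ => (1 - x) * (1 - x)) G := by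
      rw [cfc_mul (fun x : ℝ => 1 - x) (fun x : ℝ => 1 - x) G,
        cfc_sub (fun _ : ℝ => (1 : ℝ)) (fun x : ℝ => x) G, cfc_const_one ℝ G, cfc_id' ℝ G]
    rw [h1]
    exact cfc_mono fun x _ => max_le (by nlinarith [sq_nonneg x]) (mul_self_nonneg _)

/-- If `P` is a projection that is one of the summands of `G = P + H`, and `H ≤ m`, then the weight
of `P` off `G` is controlled by its overlap with `H`. -/
lemma trace_proj_mul_sq_one_sub_le {P H : Matrix d d ℂ} (hP : P.PosSemidef) (hPP : P * P = P)
    (hH : H.PosSemidef) {m : ℝ} (hm : 0 < m) (hHm : H ≤ m • (1 : Matrix d d ℂ)) :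
    ((P * ((1 - (P + H)) * (1 - (P + H)))).trace).re ≤ m * ((P * H).trace).re := by
  have h1 : H * H ≤ m • H := by
    have hT : m⁻¹ • H ≤ 1 := by
      have := smul_le_smul_of_nonneg_left hHm (inv_nonneg.mpr hm.le)
      rwa [smul_smul, inv_mul_cancel₀ hm.ne', one_smul] at this
    have h2 := sq_le_self_of_le_one (hH.smul (inv_nonneg.mpr hm.le)) hT
    have h3 := smul_le_smul_of_nonneg_left h2 (sq_nonneg m)
    rw [Matrix.smul_mul, Matrix.mul_smul, smul_smul, smul_smul, smul_smul] at h3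
    convert h3 using 2
    · field_simp
      simp
    · field_simp
  have h2 : P * ((1 - (P + H)) * (1 - (P + H))) * P = P * (H * H) * P := by
    have a1 : P * (1 - (P + H)) = - (P * H) := by
      rw [Matrix.mul_sub, Matrix.mul_add, hPP]; simp
    have a2 : (1 - (P + H)) * P = - (H * P) := by
      rw [Matrix.sub_mul, Matrix.add_mul, hPP]; simp
    calc P * ((1 - (P + H)) * (1 - (P + H))) * P
        = (P * (1 - (P + H))) * ((1 - (P + H)) * P) := by simp only [Matrix.mul_assoc]
      _ = P * (H * H) * P := by rw [a1, a2]; simp only [neg_mul_neg, Matrix.mul_assoc]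
  have h3 : ∀ X : Matrix d d ℂ, (P * X * P).trace = (P * X).trace := fun X => by
    rw [Matrix.trace_mul_comm, ← Matrix.mul_assoc, hPP]
  rw [← h3, h2, h3]
  refine (trace_mul_re_mono hP h1).trans (le_of_eq ?_)
  rw [Matrix.mul_smul, Matrix.trace_smul, Complex.smul_re, smul_eq_mul]

end RankOne

/-! ### The linear bound when all but two hypotheses are projections -/

section RankOneBound

variable {ι d : Type*} [Fintype ι] [DecidableEq ι] [Fintype d] [DecidableEq d]

/-- Suppose that all but two of the hypotheses are multiples `a k P k` of projections
(as rank-one operators are), and that every pair can be discriminated with error less than `ε`.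
Each `P k` with `k ∈ S` serves as test for `A k`. The remaining hypotheses, of which there are
at most two, are tested by `Q F Q`, where `Q` smoothly projects onto the complement of the `P k`,
and `F` is a test for the pair. No square root is lost, since the disturbance of `F` by `Q` enters
only through `Q (1 - F) Q ≤ 2 (1 - F) + 2 (1 - Q)`. -/
theorem optError_le_mul_of_lt {A : ι → Matrix d d ℂ} (hA : ∀ i, (A i).PosSemidef)
    {S : Finset ι} (hS : Sᶜ.card ≤ 2) (hproj : ∀ i ∈ S, A i * A i = ((A i).trace).re • A i)
    (hpos : ∀ i, 0 < ((A i).trace).re) {κ : ℝ}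
    (hκ : ∀ i j, ((A i).trace).re ≤ κ * ((A j).trace).re)
    {ε : ℝ} (hε : 0 < ε) (h : ∀ i j, i ≠ j → optError ![A i, A j] < ε) :
    optError A ≤ 240 * (Fintype.card ι : ℝ) ^ 4 * (κ * ε) := by
  set r : ℝ := (Fintype.card ι : ℝ) with hr
  rcases isEmpty_or_nonempty ι with hι | ⟨⟨i₀⟩⟩
  · have h1 := optError_le hA (isPOVM_zero (ι := ι))
    simp only [povmError, univ_eq_empty, sum_empty] at h1
    simpa [hr] using h1
  have hr1 : 1 ≤ r := by rw [hr]; exact_mod_cast Fintype.card_pos_iff.mpr ⟨i₀⟩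
  have hκ1 : 1 ≤ κ := by
    have := hκ i₀ i₀
    by_contra hlt
    nlinarith [hpos i₀]
  choose! T hT0 hT1 hTε using fun i j (hij : i ≠ j) => exists_test_of_optError_lt (hA j) (h i j hij)
  have hD : ∀ i j, i ≠ j → (1 - T i j).PosSemidef := fun i j hij => Matrix.le_iff.mp (hT1 i j hij)
  have hTA : ∀ i j, i ≠ j → ((A j * T i j).trace).re ≤ ε := fun i j hij => by
    linarith [hTε i j hij, trace_mul_re_nonneg (hA i) (hD i j hij)]
  have hDA : ∀ i j, i ≠ j → ((A i * (1 - T i j)).trace).re ≤ ε := fun i j hij => by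
    linarith [hTε i j hij, trace_mul_re_nonneg (hA j) (hT0 i j hij)]
  -- the projections
  obtain ⟨P, hP⟩ : ∃ P : ι → Matrix d d ℂ, ∀ k, P k = (((A k).trace).re)⁻¹ • A k :=
    ⟨_, fun _ => rfl⟩
  have hP0 : ∀ k, (P k).PosSemidef := fun k =>
    hP k ▸ (hA k).smul (inv_nonneg.mpr (hpos k).le)
  have hAP : ∀ k, A k = ((A k).trace).re • P k := fun k => by
    rw [hP, smul_smul, mul_inv_cancel₀ (hpos k).ne', one_smul]
  have hAPk : ∀ k ∈ S, A k * P k = A k := fun k hk => by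
    rw [hP, Matrix.mul_smul, hproj k hk, smul_smul, inv_mul_cancel₀ (hpos k).ne', one_smul]
  have hPP : ∀ k ∈ S, P k * P k = P k := fun k hk => by
    have := congrArg (fun X => (((A k).trace).re)⁻¹ • X) (hAPk k hk)
    simpa only [← Matrix.smul_mul, ← hP] using this
  have hP1 : ∀ k ∈ S, P k ≤ 1 := fun k hk => proj_le_one (hP0 k) (hPP k hk)
  set η := 4 * κ * ε with hη
  have hεη : ε ≤ η := by nlinarith
  have hη0 : 0 < η := hε.trans_le hεη
  -- all overlaps with the projections are small
  have hov : ∀ i, ∀ k ∈ S, i ≠ k → ((A i * P k).trace).re ≤ η := by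
    intro i k hk hik
    have h1 : ((((A k).trace).re • P k * (1 - T k i)).trace).re + ((A i * T k i).trace).re ≤ ε := by
      rw [← hAP]; exact hTε k i hik.symm
    refine (trace_mul_proj_le (hA i) (hP0 k) (hPP k hk) (hT0 k i hik.symm) (hT1 k i hik.symm)
      (hpos k) h1).trans ?_
    have : ((A i).trace).re / ((A k).trace).re ≤ κ := (div_le_iff₀ (hpos k)).mpr (hκ i k)
    have := mul_le_mul_of_nonneg_right this hε.le
    nlinarith
  set G := ∑ k ∈ S, P k with hG
  have hG0 : G.PosSemidef := Matrix.posSemidef_sum _ fun k _ => hP0 k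
  obtain ⟨Q, hQ0, hQ1, hQG, hQsq⟩ := exists_smooth_complement hG0
  have hQQ := sq_le_self_of_le_one hQ0 hQ1
  have hcard : ∀ s : Finset ι, (s.card : ℝ) ≤ r := fun s => by
    rw [hr]; exact_mod_cast card_le_univ s
  -- the remaining hypotheses are almost supported off the projections
  have hcompl : ∀ i, i ∉ S → ((A i * (1 - Q)).trace).re ≤ 2 * (r * η) := by
    intro i hi
    refine (trace_mul_re_mono (hA i) hQG).trans ?_
    rw [Matrix.mul_smul, Matrix.trace_smul, Complex.smul_re, smul_eq_mul, hG, Matrix.mul_sum,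
      Matrix.trace_sum, Complex.re_sum]
    refine mul_le_mul_of_nonneg_left ?_ zero_le_two
    refine (Finset.sum_le_sum fun k hk => hov i k hk (ne_of_mem_of_not_mem hk hi).symm).trans ?_
    rw [sum_const, nsmul_eq_mul]
    exact mul_le_mul_of_nonneg_right (hcard _) hη0.le
  have hin : ∀ j ∈ S, ((A j * Q).trace).re ≤ r ^ 2 * η := by
    intro j hj
    have hGj : G = P j + ∑ k ∈ S.erase j, P k := (Finset.add_sum_erase S P hj).symm
    have hH0 : (∑ k ∈ S.erase j, P k).PosSemidef := Matrix.posSemidef_sum _ fun k _ => hP0 k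
    have hHm : ∑ k ∈ S.erase j, P k ≤ r • (1 : Matrix d d ℂ) := by
      calc ∑ k ∈ S.erase j, P k ≤ ∑ k ∈ S.erase j, (1 : Matrix d d ℂ) :=
            Finset.sum_le_sum fun k hk => hP1 k (mem_of_mem_erase hk)
        _ = ((S.erase j).card : ℝ) • (1 : Matrix d d ℂ) := by
            rw [sum_const, ← Nat.cast_smul_eq_nsmul ℝ]
        _ ≤ r • (1 : Matrix d d ℂ) :=
            smul_le_smul_of_nonneg_right (hcard _) Matrix.PosSemidef.one.nonneg
    have h1 := trace_proj_mul_sq_one_sub_le (hP0 j) (hPP j hj) hH0 (by linarith) hHm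
    rw [← hGj] at h1
    have h2 := (trace_mul_re_mono (hP0 j) hQsq).trans h1
    have h3 := mul_le_mul_of_nonneg_left h2 (hpos j).le
    have h4 : ∀ X : Matrix d d ℂ, ((A j).trace).re * ((P j * X).trace).re = ((A j * X).trace).re := by
      intro X
      conv_rhs => rw [hAP j]
      rw [Matrix.smul_mul, Matrix.trace_smul, Complex.smul_re, smul_eq_mul]
    rw [h4, mul_left_comm, h4, Matrix.mul_sum, Matrix.trace_sum, Complex.re_sum] at h3
    refine h3.trans ?_
    have h5 := Finset.sum_le_sum fun k (hk : k ∈ S.erase j) =>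
      hov j k (mem_of_mem_erase hk) (ne_of_mem_erase hk).symm
    rw [sum_const, nsmul_eq_mul] at h5
    have h6 := h5.trans (mul_le_mul_of_nonneg_right (hcard _) hη0.le)
    nlinarith
  -- tests for the remaining hypotheses
  have hF : ∀ i, ∃ F : Matrix d d ℂ, F.PosSemidef ∧ F ≤ 1 ∧ ((A i * (1 - F)).trace).re ≤ ε ∧
      (i ∉ S → ∀ j, j ∉ S → j ≠ i → ((A j * F).trace).re ≤ ε) := by
    intro i
    by_cases hex : i ∉ S ∧ ∃ j, j ∉ S ∧ j ≠ i
    · obtain ⟨hi, j, hj, hji⟩ := hex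
      refine ⟨T i j, hT0 i j hji.symm, hT1 i j hji.symm, hDA i j hji.symm, ?_⟩
      intro _ k hk hki
      have : k = j := by
        by_contra hkj
        have hsub : ({i, j, k} : Finset ι) ⊆ Sᶜ := by
          intro x hx
          simp only [mem_insert, mem_singleton] at hx
          rcases hx with rfl | rfl | rfl <;> simpa
        have := card_le_card hsub
        rw [card_eq_three.mpr ⟨i, j, k, hji.symm, hki.symm, Ne.symm hkj, rfl⟩] at this
        omega
      rw [this]
      exact hTA i j hji.symm
    · refine ⟨1, Matrix.PosSemidef.one, le_rfl, by simpa using hε.le, ?_⟩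
      intro hi j hj hji
      exact absurd ⟨hi, j, hj, hji⟩ hex
  choose F hF0 hF1 hFε hFo using hF
  have hFD : ∀ i, (1 - F i).PosSemidef := fun i => Matrix.le_iff.mp (hF1 i)
  have hQc : (1 - Q).PosSemidef := Matrix.le_iff.mp hQ1
  have hQc1 : 1 - Q ≤ 1 := by simpa using hQ0.nonneg
  -- compressing a contraction by `Q` changes it little
  have hcomp : ∀ X : Matrix d d ℂ, X.PosSemidef → X ≤ 1 →
      Q * X * Q ≤ (2 : ℝ) • X + (2 : ℝ) • (1 - Q) := by
    intro X hX0 hX1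
    have h1 := add_mul_mul_add_le hX0 Matrix.isHermitian_one hQc.1.neg
    rw [show (1 : Matrix d d ℂ) + -(1 - Q) = Q by abel] at h1
    refine h1.trans ?_
    rw [Matrix.one_mul, Matrix.mul_one, neg_mul, neg_mul, mul_neg, neg_neg]
    gcongr
    refine le_trans ?_ (sq_le_self_of_le_one hQc hQc1)
    rw [Matrix.le_iff]
    refine PosSemidef.of_eq (PosSemidef.sandwich (Matrix.le_iff.mp hX1) hQc.1) ?_
    noncomm_ring
  have hQFQ : ∀ X : Matrix d d ℂ, X ≤ 1 → Q * X * Q ≤ Q := by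
    intro X hX1
    refine le_trans ?_ hQQ
    rw [Matrix.le_iff]
    refine PosSemidef.of_eq (PosSemidef.sandwich (Matrix.le_iff.mp hX1) hQ0.1) ?_
    noncomm_ring
  have hre : ∀ (B X Y : Matrix d d ℂ), ((B * ((2 : ℝ) • X + (2 : ℝ) • Y)).trace).re =
      2 * ((B * X).trace).re + 2 * ((B * Y).trace).re := by
    intro B X Y
    simp only [Matrix.mul_add, Matrix.mul_smul, Matrix.trace_add, Matrix.trace_smul,
      Complex.add_re, Complex.smul_re, smul_eq_mul]
  have hr2 : r ≤ r ^ 2 := by nlinarith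
  have hrη : r * η ≤ r ^ 2 * η := mul_le_mul_of_nonneg_right hr2 hη0.le
  have hη2 : η ≤ r ^ 2 * η := le_mul_of_one_le_left hη0.le (by linarith)
  have first : ∀ i, ((A i * (1 - if i ∈ S then P i else Q * F i * Q)).trace).re
      ≤ 10 * (r ^ 2 * η) := by
    intro i
    split_ifs with hi
    · have h0 : A i * (1 - P i) = 0 := by
        rw [Matrix.mul_sub, Matrix.mul_one, hAPk i hi, sub_self]
      rw [h0]
      simp only [Matrix.trace_zero, Complex.zero_re]
      positivity
    · have h1 : 1 - Q * F i * Q ≤ (2 : ℝ) • (1 - F i) + (2 : ℝ) • ((1 - Q) + (1 - Q)) := by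
        have e : 1 - Q * F i * Q = (1 - Q * Q) + Q * (1 - F i) * Q := by noncomm_ring
        have e1 : 1 - Q * Q ≤ (2 : ℝ) • (1 - Q) := by
          rw [Matrix.le_iff]
          refine PosSemidef.of_eq (PosSemidef.sandwich Matrix.PosSemidef.one hQc.1) ?_
          rw [two_smul]; noncomm_ring
        rw [e]
        refine (add_le_add e1 (hcomp _ (hFD i) (by simpa using (hF0 i).nonneg))).trans
          (le_of_eq ?_)
        module
      refine (trace_mul_re_mono (hA i) h1).trans ?_
      rw [hre, Matrix.mul_add, Matrix.trace_add, Complex.add_re]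
      have := hcompl i hi
      have := hFε i
      linarith
  have second : ∀ i j, i ≠ j → ((A i * if j ∈ S then P j else Q * F j * Q).trace).re
      ≤ 10 * (r ^ 2 * η) := by
    intro i j hij
    split_ifs with hj
    · have := hov i j hj hij
      linarith
    · by_cases hi : i ∈ S
      · have := (trace_mul_re_mono (hA i) (hQFQ _ (hF1 j))).trans (hin i hi)
        linarith
      · refine (trace_mul_re_mono (hA i) (hcomp _ (hF0 j) (hF1 j))).trans ?_
        rw [hre]
        have := hcompl i hi
        have := hFo j hj i hi hij
        linarith
  have hmain := optError_le_of_tests hA (T := fun i => if i ∈ S then P i else Q * F i * Q)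
    (fun i => by
      split_ifs
      · exact hP0 i
      · exact PosSemidef.sandwich (hF0 i) hQ0.1)
    (fun i => by
      split_ifs with hi
      · exact hP1 i hi
      · exact (hQFQ _ (hF1 i)).trans hQ1)
  refine hmain.trans ?_
  have s1 := Finset.sum_le_sum (s := univ) fun i _ => first i
  have s2 := Finset.sum_le_sum (s := univ) fun i _ =>
    (Finset.sum_le_sum fun j (hj : j ∈ univ.erase i) => second i j (ne_of_mem_erase hj).symm).trans
      ((by
        rw [sum_const, nsmul_eq_mul]
        exact mul_le_mul_of_nonneg_right (hcard _) (by positivity)) :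
          ∑ j ∈ univ.erase i, 10 * (r ^ 2 * η) ≤ r * (10 * (r ^ 2 * η)))
  rw [sum_const, nsmul_eq_mul, card_univ, ← hr] at s1 s2
  have h1 : r * (r ^ 2 * η) ≤ r ^ 2 * (r ^ 2 * η) := mul_le_mul_of_nonneg_right hr2 (by positivity)
  have h2 : 240 * r ^ 4 * (κ * ε) = 60 * (r ^ 2 * (r ^ 2 * η)) := by rw [hη]; ring
  rw [h2]
  nlinarith

end RankOneBound

/-! ### The quantum Chernoff bound -/

section ChernoffBound

/-- The power `x ^ s` of a non-negative number, with `0 ^ 0 = 0`; this is the function underlying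
`supportPow`. -/
noncomputable def posPow (x s : ℝ) : ℝ := if 0 < x then x ^ s else 0

lemma posSemidef_pair {d : Type*} {A B : Matrix d d ℂ} (hA : A.PosSemidef) (hB : B.PosSemidef)
    (i : Fin 2) : (![A, B] i).PosSemidef := by
  fin_cases i
  · exact hA
  · exact hB

variable {d : Type*} [Fintype d] [DecidableEq d]

lemma continuousOn_spectrum (A : Matrix d d ℂ) (f : ℝ → ℝ) :
    ContinuousOn f (spectrum ℝ A) :=
  Matrix.finite_real_spectrum.continuousOn f

lemma spectrum_nonneg_of_posSemidef {A : Matrix d d ℂ} (hA : A.PosSemidef) {x : ℝ}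
    (hx : x ∈ spectrum ℝ A) : 0 ≤ x :=
  spectrum_nonneg_of_nonneg hA.nonneg hx

lemma posSemidef_supportPow (A : Matrix d d ℂ) (s : ℝ) : (supportPow A s).PosSemidef := by
  refine (cfc_nonneg fun x _ => ?_).posSemidef
  split_ifs with h
  · exact Real.rpow_nonneg h.le s
  · exact le_rfl

lemma supportPow_mul_supportPow (A : Matrix d d ℂ) (s t : ℝ) :
    supportPow A s * supportPow A t = supportPow A (s + t) := by
  rw [supportPow, supportPow, supportPow, ← cfc_mul _ _ A (continuousOn_spectrum A _)
    (continuousOn_spectrum A _)]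
  refine cfc_congr fun x _ => ?_
  split_ifs with h
  · rw [Real.rpow_add h]
  · simp

lemma supportPow_one {A : Matrix d d ℂ} (hA : A.PosSemidef) : supportPow A 1 = A := by
  have hsa : IsSelfAdjoint A := hA.1
  conv_rhs => rw [← cfc_id' ℝ A]
  refine cfc_congr fun x hx => ?_
  split_ifs with h
  · rw [Real.rpow_one]
  · exact le_antisymm (spectrum_nonneg_of_posSemidef hA hx) (not_lt.mp h)

lemma supportPow_eq_rpow {A : Matrix d d ℂ} (hA : A.PosSemidef) {s : ℝ} (hs : 0 < s) :
    supportPow A s = A ^ s := by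
  rw [CFC.rpow_eq_cfc_real hA.nonneg]
  refine cfc_congr fun x hx => ?_
  split_ifs with h
  · rfl
  · rw [le_antisymm (not_lt.mp h) (spectrum_nonneg_of_posSemidef hA hx), Real.zero_rpow hs.ne']

/-- Operator monotonicity of fractional powers (**Löwner–Heinz**). -/
lemma supportPow_le_supportPow {A B : Matrix d d ℂ} (hA : A.PosSemidef) (hAB : A ≤ B) {s : ℝ}
    (hs : 0 < s) (hs1 : s ≤ 1) : supportPow A s ≤ supportPow B s := by
  rw [supportPow_eq_rpow hA hs, supportPow_eq_rpow (hA.nonneg.trans hAB).posSemidef hs]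
  exact CFC.rpow_le_rpow ⟨hs.le, hs1⟩ hAB

lemma supportPow_zero_le_one (A : Matrix d d ℂ) : supportPow A 0 ≤ 1 := by
  refine cfc_le_one _ _ fun x _ => ?_
  split_ifs <;> simp

lemma isPOVM_pair {T : Matrix d d ℂ} (h0 : T.PosSemidef) (h1 : T ≤ 1) : IsPOVM ![T, 1 - T] := by
  constructor
  · intro i
    fin_cases i
    · exact h0
    · exact Matrix.le_iff.mp h1
  · simpa [Fin.sum_univ_two] using Matrix.PosSemidef.zero

lemma optError_pair_le {A B T : Matrix d d ℂ} (hA : A.PosSemidef) (hB : B.PosSemidef)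
    (h0 : T.PosSemidef) (h1 : T ≤ 1) :
    optError ![A, B] ≤ ((A * (1 - T)).trace).re + ((B * T).trace).re := by
  refine (optError_le (posSemidef_pair hA hB) (isPOVM_pair h0 h1)).trans (le_of_eq ?_)
  simp [povmError, Fin.sum_univ_two]

/-- The positive part `D` of `A - B` satisfies `A ≤ B + D`, and the projection onto its support is a
test with error `Tr A - Tr D`. -/
lemma exists_posPart {A B : Matrix d d ℂ} (hA : A.PosSemidef) (hB : B.PosSemidef) :
    ∃ D : Matrix d d ℂ, D.PosSemidef ∧ A ≤ B + D ∧
      optError ![A, B] ≤ (A.trace).re - (D.trace).re := by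
  have hsa : IsSelfAdjoint (A - B) := hA.1.sub hB.1
  have hc := fun f : ℝ → ℝ => continuousOn_spectrum (A - B) f
  set P := cfc (fun x : ℝ => if 0 < x then (1 : ℝ) else 0) (A - B) with hP
  have hP0 : P.PosSemidef := (cfc_nonneg fun x _ => by split_ifs <;> simp).posSemidef
  have hP1 : P ≤ 1 := cfc_le_one _ _ fun x _ => by split_ifs <;> simp
  refine ⟨cfc (fun x : ℝ => max x 0) (A - B), (cfc_nonneg fun x _ => le_max_right _ _).posSemidef,
    ?_, ?_⟩
  · rw [← sub_le_iff_le_add']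
    conv_lhs => rw [← cfc_id' ℝ (A - B)]
    exact cfc_mono (fun x _ => le_max_left _ _) (hc _) (hc _)
  · have hD : cfc (fun x : ℝ => max x 0) (A - B) = (A - B) * P := by
      have hid : A - B = cfc (fun x : ℝ => x) (A - B) := (cfc_id' ℝ (A - B)).symm
      conv_rhs => rw [hP]; arg 1; rw [hid]
      rw [← cfc_mul _ _ (A - B) (hc _) (hc _)]
      refine cfc_congr fun x _ => ?_
      split_ifs with h
      · rw [max_eq_left h.le, mul_one]
      · rw [max_eq_right (not_lt.mp h), mul_zero]
    refine (optError_pair_le hA hB hP0 hP1).trans (le_of_eq ?_)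
    rw [hD, Matrix.mul_sub, Matrix.mul_one, Matrix.sub_mul, Matrix.trace_sub, Matrix.trace_sub,
      Complex.sub_re, Complex.sub_re]
    ring

/-- The **quantum Chernoff bound** of Audenaert et al. For `0 < s < 1` the proof compares both
operators with `X = B + (A - B)₊`, which dominates `A` and `B`, by operator monotonicity of the
powers `s` and `1 - s`; for `s = 0` and `s = 1` the support projections are the tests. -/
theorem optError_pair_le_chernoffQ {A B : Matrix d d ℂ} (hA : A.PosSemidef) (hB : B.PosSemidef)
    {s : ℝ} (hs : s ∈ Set.Icc (0 : ℝ) 1) : optError ![A, B] ≤ chernoffQ A B s := by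
  have supp : ∀ M : Matrix d d ℂ, M.PosSemidef → M * supportPow M 0 = M := fun M hM => by
    conv_lhs => rw [← supportPow_one hM]
    rw [supportPow_one hM]
    nth_rw 1 [← supportPow_one hM]
    rw [supportPow_mul_supportPow M, add_zero, supportPow_one hM]
  rcases hs.1.eq_or_lt with rfl | h0
  · refine (optError_pair_le hA hB (posSemidef_supportPow A 0) (supportPow_zero_le_one A)).trans
      (le_of_eq ?_)
    rw [chernoffQ, Matrix.mul_sub, supp A hA, sub_zero, supportPow_one hB, Matrix.mul_one, sub_self,
      Matrix.trace_zero, Complex.zero_re, zero_add, Matrix.trace_mul_comm]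
  rcases hs.2.eq_or_lt with rfl | h1
  · have hP1 := supportPow_zero_le_one B
    refine (optError_pair_le hA hB (T := 1 - supportPow B 0) (Matrix.le_iff.mp hP1)
      (by simpa using (posSemidef_supportPow B 0).nonneg)).trans (le_of_eq ?_)
    rw [chernoffQ, Matrix.mul_sub, Matrix.mul_sub, Matrix.mul_sub, supp B hB, sub_self,
      supportPow_one hA]
    simp
  · obtain ⟨D, hD, hle, hopt⟩ := exists_posPart hA hB
    refine hopt.trans ?_
    have hX : (B + D).PosSemidef := hB.add hD
    have hBX : B ≤ B + D := le_add_of_nonneg_right hD.nonneg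
    have hs1 : 0 < 1 - s := by linarith
    have m1 := supportPow_le_supportPow hA hle hs1 (by linarith)
    have m2 := supportPow_le_supportPow hB hBX hs1 (by linarith)
    have m3 := supportPow_le_supportPow hA hle h0 h1.le
    have m4 := supportPow_le_supportPow hB hBX h0 h1.le
    have split : ∀ M : Matrix d d ℂ, M.PosSemidef →
        ((supportPow M s * supportPow M (1 - s)).trace).re = (M.trace).re := fun M hM => by
      rw [supportPow_mul_supportPow M, add_sub_cancel, supportPow_one hM]
    have i1 := trace_mul_re_mono (posSemidef_supportPow A s)
      (sub_le_sub_right m1 (supportPow B (1 - s)))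
    have i2 := trace_mul_re_mono (Matrix.le_iff.mp m2) m3
    have i3 := trace_mul_re_mono (posSemidef_supportPow B (1 - s)) m4
    rw [Matrix.trace_mul_comm, Matrix.trace_mul_comm _ (supportPow (B + D) s)] at i2
    rw [Matrix.trace_mul_comm, Matrix.trace_mul_comm _ (supportPow (B + D) s)] at i3
    rw [Matrix.mul_sub, Matrix.trace_sub, Complex.sub_re, split A hA] at i1
    rw [Matrix.mul_sub (supportPow (B + D) s), Matrix.trace_sub, Complex.sub_re, split _ hX] at i2
    rw [split B hB] at i3
    rw [Matrix.trace_add, Complex.add_re] at i2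
    rw [chernoffQ]
    linarith

lemma chernoffQ_nonneg (A B : Matrix d d ℂ) (s : ℝ) : 0 ≤ chernoffQ A B s :=
  trace_mul_re_nonneg (posSemidef_supportPow A s) (posSemidef_supportPow B _)

lemma chernoffQMin_le (A B : Matrix d d ℂ) {s : ℝ} (hs : s ∈ Set.Icc (0 : ℝ) 1) :
    chernoffQMin A B ≤ chernoffQ A B s :=
  csInf_le ⟨0, by rintro _ ⟨t, _, rfl⟩; exact chernoffQ_nonneg A B t⟩ ⟨s, hs, rfl⟩

lemma optError_pair_le_chernoffQMin {A B : Matrix d d ℂ} (hA : A.PosSemidef)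
    (hB : B.PosSemidef) : optError ![A, B] ≤ chernoffQMin A B :=
  le_csInf ⟨_, 0, by simp, rfl⟩
    (by rintro _ ⟨s, hs, rfl⟩; exact optError_pair_le_chernoffQ hA hB hs)

end ChernoffBound

/-! ### Chernoff sums in a diagonalization -/

section Diagonalization

variable {d : Type*} [Fintype d] [DecidableEq d]

/-- The functional calculus can be computed in any diagonalization. -/
lemma cfc_conj_diagonal {U : Matrix d d ℂ} (hU : U ∈ unitaryGroup d ℂ) (α : d → ℝ) (f : ℝ → ℝ) :
    cfc f (U * diagonal (fun i => (α i : ℂ)) * star U) =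
      U * diagonal (fun i => (f (α i) : ℂ)) * star U := by
  have hH : (U * diagonal (fun i => (α i : ℂ)) * star U).IsHermitian := by
    refine Matrix.isHermitian_mul_mul_conjTranspose U ?_
    exact Matrix.isHermitian_diagonal_of_self_adjoint _ (by ext i; simp)
  set A := U * diagonal (fun i => (α i : ℂ)) * star U with hA
  set W : Matrix d d ℂ := (hH.eigenvectorUnitary : Matrix d d ℂ) with hW
  have hWs : star W * W = 1 := Unitary.coe_star_mul_self hH.eigenvectorUnitary
  have hWs' : W * star W = 1 := Unitary.coe_mul_star_self hH.eigenvectorUnitary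
  have hUs : star U * U = 1 := (mem_unitaryGroup_iff').mp hU
  have hUs' : U * star U = 1 := (mem_unitaryGroup_iff).mp hU
  have hspec : A = W * diagonal (fun i => (hH.eigenvalues i : ℂ)) * star W := hH.spectral_theorem
  have hcfc : cfc f A = W * diagonal (fun i => (f (hH.eigenvalues i) : ℂ)) * star W :=
    hH.cfc_eq f
  -- the unitary `M = W* U` intertwines the two diagonal matrices
  set M := star W * U with hM
  have hint : diagonal (fun i => (hH.eigenvalues i : ℂ)) * M = M * diagonal (fun i => (α i : ℂ)) := by
    have h1 : star W * A * U = diagonal (fun i => (hH.eigenvalues i : ℂ)) * M := by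
      conv_lhs => rw [hspec]
      simp only [hM, ← Matrix.mul_assoc, hWs, Matrix.one_mul]
    have h2 : star W * A * U = M * diagonal (fun i => (α i : ℂ)) := by
      rw [hA, hM]
      simp only [Matrix.mul_assoc, hUs, Matrix.mul_one]
    rw [← h1, h2]
  have hint' : diagonal (fun i => (f (hH.eigenvalues i) : ℂ)) * M =
      M * diagonal (fun i => (f (α i) : ℂ)) := by
    ext i j
    have h1 := congrFun (congrFun hint i) j
    rw [diagonal_mul, mul_diagonal] at h1 ⊢
    by_cases hz : M i j = 0
    · simp [hz]
    · rw [mul_comm (M i j)] at h1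
      have h2 : hH.eigenvalues i = α j := by exact_mod_cast mul_right_cancel₀ hz h1
      rw [h2, mul_comm]
  rw [hcfc]
  calc W * diagonal (fun i => (f (hH.eigenvalues i) : ℂ)) * star W
      = W * (diagonal (fun i => (f (hH.eigenvalues i) : ℂ)) * M) * star U := by
        rw [hM]; simp only [Matrix.mul_assoc, hUs', Matrix.mul_one]
    _ = _ := by
        rw [hint', hM]; simp only [← Matrix.mul_assoc, hWs', Matrix.one_mul]

lemma exists_diagonalization {A : Matrix d d ℂ} (hA : A.PosSemidef) :
    ∃ U ∈ unitaryGroup d ℂ, ∃ α : d → ℝ, (∀ i, 0 ≤ α i) ∧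
      A = U * diagonal (fun i => (α i : ℂ)) * star U :=
  ⟨hA.1.eigenvectorUnitary, hA.1.eigenvectorUnitary.2, hA.1.eigenvalues, hA.eigenvalues_nonneg,
    hA.1.spectral_theorem⟩

/-- `Tr D₁ M D₂ M*` for diagonal `D₁`, `D₂`. -/
lemma trace_diagonal_mul_mul_diagonal_mul_re (α β : d → ℝ) (M : Matrix d d ℂ) :
    ((diagonal (fun i => (α i : ℂ)) * M * diagonal (fun i => (β i : ℂ)) * star M).trace).re =
      ∑ i, ∑ j, α i * β j * ‖M i j‖ ^ 2 := by
  rw [Matrix.trace, Complex.re_sum]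
  refine sum_congr rfl fun i _ => ?_
  rw [diag_apply, Matrix.mul_apply, Complex.re_sum]
  refine sum_congr rfl fun j _ => ?_
  rw [mul_diagonal, diagonal_mul, star_apply]
  have : (α i : ℂ) * M i j * (β j : ℂ) * star (M i j) =
      ((α i * β j * ‖M i j‖ ^ 2 : ℝ) : ℂ) := by
    have h := Complex.mul_conj (M i j)
    rw [Complex.normSq_eq_norm_sq] at h
    push_cast at h ⊢
    rw [← h]
    simp only [RCLike.star_def]
    ring
  rw [this, Complex.ofReal_re]

/-- The reduction of Nussbaum and Szkoła: in terms of spectral decompositions of `A` and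
`B`, `Tr A ^ s B ^ (1 - s)` is a classical Chernoff sum. -/
lemma chernoffQ_conj_diagonal {U V : Matrix d d ℂ} (hU : U ∈ unitaryGroup d ℂ)
    (hV : V ∈ unitaryGroup d ℂ) (α β : d → ℝ) (s : ℝ) :
    chernoffQ (U * diagonal (fun i => (α i : ℂ)) * star U)
        (V * diagonal (fun i => (β i : ℂ)) * star V) s =
      ∑ i, ∑ j, posPow (α i) s * posPow (β j) (1 - s) * ‖(star U * V) i j‖ ^ 2 := by
  simp only [posPow]
  rw [chernoffQ, supportPow, supportPow, cfc_conj_diagonal hU, cfc_conj_diagonal hV,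
    ← trace_diagonal_mul_mul_diagonal_mul_re, star_mul, star_star]
  congr 1
  rw [Matrix.mul_assoc, Matrix.mul_assoc, Matrix.trace_mul_comm]
  simp only [Matrix.mul_assoc]

end Diagonalization

/-! ### Lower bounds on the optimal error -/

section LowerBound

variable {ι d : Type*} [Fintype ι] [Fintype d] [DecidableEq d]

lemma optError_pair_le_optError {A : ι → Matrix d d ℂ} (hA : ∀ i, (A i).PosSemidef) {i j : ι}
    (hij : i ≠ j) : optError ![A i, A j] ≤ optError A := by
  classical
  refine le_optError fun E hE => ?_
  have hpair : IsPOVM ![E i, E j] := by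
    refine ⟨posSemidef_pair (hE.1 i) (hE.1 j), ?_⟩
    rw [← Matrix.le_iff, Fin.sum_univ_two]
    refine le_trans ?_ (Matrix.le_iff.mpr hE.2)
    have := Finset.sum_le_sum_of_subset_of_nonneg (f := E) (subset_univ {i, j})
      (fun k _ _ => (hE.1 k).nonneg)
    rwa [sum_pair hij] at this
  refine (optError_le (posSemidef_pair (hA i) (hA j)) hpair).trans ?_
  have := Finset.sum_le_sum_of_subset_of_nonneg (f := fun k => ((A k * (1 - E k)).trace).re)
    (subset_univ {i, j})
    (fun k _ _ => trace_mul_re_nonneg (hA k) (Matrix.le_iff.mp (hE.le_one k)))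
  rw [sum_pair hij] at this
  simpa [povmError, Fin.sum_univ_two] using this

/-- The **Nussbaum–Szkoła bound**: the optimal error is at least one half of the optimal error of a
classical binary problem. -/
theorem half_sum_min_le_optError {U V : Matrix d d ℂ} (hU : U ∈ unitaryGroup d ℂ)
    (hV : V ∈ unitaryGroup d ℂ) {α β : d → ℝ} (hα : ∀ i, 0 ≤ α i) (hβ : ∀ i, 0 ≤ β i) :
    1 / 2 * ∑ i, ∑ j, min (α i) (β j) * ‖(star U * V) i j‖ ^ 2 ≤
      optError ![U * diagonal (fun i => (α i : ℂ)) * star U,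
        V * diagonal (fun i => (β i : ℂ)) * star V] := by
  have psd : ∀ (W : Matrix d d ℂ) (γ : d → ℝ), (∀ i, 0 ≤ γ i) →
      (W * diagonal (fun i => (γ i : ℂ)) * star W).PosSemidef := fun W γ hγ =>
    (Matrix.PosSemidef.diagonal fun i => by simpa using hγ i).mul_mul_conjTranspose_same W
  have hUs' : U * star U = 1 := (mem_unitaryGroup_iff).mp hU
  have hVs' : V * star V = 1 := (mem_unitaryGroup_iff).mp hV
  set A := U * diagonal (fun i => (α i : ℂ)) * star U with hA
  set B := V * diagonal (fun i => (β i : ℂ)) * star V with hB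
  have hA0 : A.PosSemidef := psd U α hα
  have hB0 : B.PosSemidef := psd V β hβ
  -- quadratic expressions in a test, in the two eigenbases
  have quadA : ∀ T : Matrix d d ℂ, T.IsHermitian →
      ((A * (T * T)).trace).re = ∑ i, ∑ j, α i * ‖(star U * T * V) i j‖ ^ 2 := by
    intro T hT
    have h := trace_diagonal_mul_mul_diagonal_mul_re α (fun _ => 1) (star U * T * V)
    simp only [mul_one] at h
    rw [← h]
    have hd : diagonal (fun _ : d => ((1 : ℝ) : ℂ)) = 1 := by simp
    have hTs : star T = T := hT
    rw [hd, Matrix.mul_one, hA, star_mul, star_mul, star_star, hTs]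
    congr 1
    rw [Matrix.mul_assoc, Matrix.mul_assoc, Matrix.trace_mul_comm]
    congr 1
    calc diagonal (fun i => (α i : ℂ)) * (star U * (T * T)) * U
        = diagonal (fun i => (α i : ℂ)) * (star U * (T * (1 * T))) * U := by rw [Matrix.one_mul]
      _ = _ := by rw [← hVs']; simp only [Matrix.mul_assoc]
  have quadB : ∀ T : Matrix d d ℂ, T.IsHermitian →
      ((B * (T * T)).trace).re = ∑ i, ∑ j, β j * ‖(star U * T * V) i j‖ ^ 2 := by
    intro T hT
    have h := trace_diagonal_mul_mul_diagonal_mul_re (fun _ => 1) β (star U * T * V)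
    simp only [one_mul] at h
    rw [← h]
    have hd : diagonal (fun _ : d => ((1 : ℝ) : ℂ)) = 1 := by simp
    have hTs : star T = T := hT
    rw [hd, Matrix.one_mul, hB, star_mul, star_mul, star_star, hTs]
    congr 1
    rw [Matrix.trace_mul_comm, Matrix.mul_assoc T T, Matrix.trace_mul_comm]
    calc (T * (V * diagonal (fun i => (β i : ℂ)) * star V) * T).trace
        = (U * star U * (T * (V * diagonal (fun i => (β i : ℂ)) * star V) * T)).trace := by
          rw [hUs', Matrix.one_mul]
      _ = _ := by
          rw [Matrix.mul_assoc U, Matrix.trace_mul_comm]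
          simp only [Matrix.mul_assoc]
  refine le_optError fun E hE => ?_
  have hT0 := hE.1 0
  have hT1 := hE.le_one 0
  have hD : (1 - E 0).PosSemidef := Matrix.le_iff.mp hT1
  have h1 : E 0 ≤ 1 - E 1 := by
    have := hE.2
    rw [Fin.sum_univ_two] at this
    rw [Matrix.le_iff]
    refine PosSemidef.of_eq this ?_
    abel
  have herr : ((A * ((1 - E 0) * (1 - E 0))).trace).re + ((B * (E 0 * E 0)).trace).re ≤
      povmError ![A, B] E := by
    have e1 := trace_mul_re_mono hA0
      (sq_le_self_of_le_one hD (by simpa using hT0.nonneg))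
    have e2 := trace_mul_re_mono hB0 ((sq_le_self_of_le_one hT0 hT1).trans h1)
    simp only [povmError, Fin.sum_univ_two, cons_val_zero, cons_val_one]
    linarith
  refine le_trans ?_ herr
  rw [quadA _ hD.1, quadB _ hT0.1, mul_sum, ← sum_add_distrib]
  refine sum_le_sum fun i _ => ?_
  rw [mul_sum, ← sum_add_distrib]
  refine sum_le_sum fun j _ => ?_
  have hsum : (star U * V) i j = (star U * (1 - E 0) * V) i j + (star U * E 0 * V) i j := by
    rw [← Matrix.add_apply, ← Matrix.add_mul, ← Matrix.mul_add, sub_add_cancel, Matrix.mul_one]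
  rw [hsum]
  set x := (star U * (1 - E 0) * V) i j
  set y := (star U * E 0 * V) i j
  have hm : 0 ≤ min (α i) (β j) := le_min (hα i) (hβ j)
  have hxy : ‖x + y‖ ^ 2 ≤ 2 * (‖x‖ ^ 2 + ‖y‖ ^ 2) := by
    have := norm_add_le x y
    nlinarith [sq_nonneg (‖x‖ - ‖y‖), norm_nonneg (x + y)]
  have h2 := mul_le_mul_of_nonneg_left hxy hm
  have h3 := mul_le_mul_of_nonneg_right (min_le_left (α i) (β j)) (sq_nonneg ‖x‖)
  have h4 := mul_le_mul_of_nonneg_right (min_le_right (α i) (β j)) (sq_nonneg ‖y‖)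
  nlinarith

end LowerBound

/-! ### Tensor powers -/

section TensorPower

variable {d : Type*}

lemma sum_prod_eq_sum_pow [Fintype d] {R : Type*} [CommSemiring R] (f : d → R) (n : ℕ) :
    ∑ x : Fin n → d, ∏ k, f (x k) = (∑ i, f i) ^ n := by
  classical
  rw [← Fin.prod_const, Finset.prod_univ_sum, Fintype.piFinset_univ]

lemma sum_sum_prod_eq_pow [Fintype d] {R : Type*} [CommSemiring R] (g : d → d → R) (n : ℕ) :
    ∑ x : Fin n → d, ∑ y : Fin n → d, ∏ k, g (x k) (y k) = (∑ i, ∑ j, g i j) ^ n := by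
  classical
  rw [← sum_prod_eq_sum_pow]
  refine sum_congr rfl fun x _ => ?_
  rw [Finset.prod_univ_sum, Fintype.piFinset_univ]

lemma tensorPow_mul [Fintype d] (A B : Matrix d d ℂ) (n : ℕ) :
    tensorPow (A * B) n = tensorPow A n * tensorPow B n := by
  classical
  ext x y
  simp only [tensorPow, of_apply, Matrix.mul_apply, Finset.prod_univ_sum, Fintype.piFinset_univ,
    Finset.prod_mul_distrib]

lemma tensorPow_star (A : Matrix d d ℂ) (n : ℕ) :
    tensorPow (star A) n = star (tensorPow A n) := by
  ext x y
  simp [tensorPow, star_apply]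

lemma tensorPow_diagonal [DecidableEq d] (a : d → ℂ) (n : ℕ) :
    tensorPow (diagonal a) n = diagonal (fun x : Fin n → d => ∏ k, a (x k)) := by
  ext x y
  simp only [tensorPow, of_apply, diagonal_apply]
  split_ifs with h
  · subst h
    simp
  · obtain ⟨k, hk⟩ := Function.ne_iff.mp h
    exact Finset.prod_eq_zero (mem_univ k) (by simp [hk])

lemma tensorPow_one [DecidableEq d] (n : ℕ) : tensorPow (1 : Matrix d d ℂ) n = 1 := by
  rw [← diagonal_one, tensorPow_diagonal]
  simp

lemma tensorPow_mem_unitaryGroup [Fintype d] [DecidableEq d] {U : Matrix d d ℂ}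
    (hU : U ∈ unitaryGroup d ℂ) (n : ℕ) : tensorPow U n ∈ unitaryGroup (Fin n → d) ℂ := by
  rw [mem_unitaryGroup_iff, ← tensorPow_star, ← tensorPow_mul, mem_unitaryGroup_iff.mp hU,
    tensorPow_one]

lemma trace_tensorPow [Fintype d] (A : Matrix d d ℂ) (n : ℕ) :
    (tensorPow A n).trace = A.trace ^ n := by
  simp only [Matrix.trace, diag_apply, tensorPow, of_apply]
  exact sum_prod_eq_sum_pow (fun i => A i i) n

variable [Fintype d]

lemma trace_iidSeq (p : ℝ) {A : Matrix d d ℂ} (hA : A.trace = 1) (n : ℕ) :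
    ((iidSeq p A n).trace).re = p := by
  rw [iidSeq, Matrix.trace_smul, trace_tensorPow, hA, one_pow, smul_eq_mul, mul_one,
    Complex.ofReal_re]

lemma iidSeq_mul_self (p : ℝ) {A : Matrix d d ℂ} (hA : A * A = A) (n : ℕ) :
    iidSeq p A n * iidSeq p A n = p • iidSeq p A n := by
  rw [iidSeq, Matrix.smul_mul, Matrix.mul_smul, ← tensorPow_mul, hA, Complex.coe_smul,
    Complex.coe_smul]

variable [DecidableEq d]

lemma posSemidef_tensorPow {A : Matrix d d ℂ} (hA : A.PosSemidef) (n : ℕ) :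
    (tensorPow A n).PosSemidef := by
  obtain ⟨X, rfl⟩ := CStarAlgebra.nonneg_iff_eq_star_mul_self.mp hA.nonneg
  rw [tensorPow_mul, tensorPow_star]
  exact posSemidef_conjTranspose_mul_self _

lemma posSemidef_iidSeq {p : ℝ} (hp : 0 ≤ p) {A : Matrix d d ℂ} (hA : A.PosSemidef) (n : ℕ) :
    (iidSeq p A n).PosSemidef := by
  have := (posSemidef_tensorPow hA n).smul hp
  rwa [← Complex.coe_smul] at this

lemma iidSeq_conj_diagonal (p : ℝ) (U : Matrix d d ℂ) (α : d → ℝ) (n : ℕ) :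
    iidSeq p (U * diagonal (fun i => (α i : ℂ)) * star U) n =
      tensorPow U n * diagonal (fun x : Fin n → d => ((p * ∏ k, α (x k) : ℝ) : ℂ)) *
        star (tensorPow U n) := by
  rw [iidSeq, tensorPow_mul, tensorPow_mul, tensorPow_star, tensorPow_diagonal, ← Matrix.smul_mul,
    ← Matrix.mul_smul, ← diagonal_smul]
  congr 3
  ext x
  simp

end TensorPower

/-! ### Multiplicativity of Chernoff sums -/

section IIDChernoff

lemma posPow_nonneg (x s : ℝ) : 0 ≤ posPow x s := by
  rw [posPow]
  split_ifs with h
  · exact Real.rpow_nonneg h.le s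
  · exact le_rfl

lemma posPow_mul {x y : ℝ} (hx : 0 ≤ x) (hy : 0 ≤ y) (s : ℝ) :
    posPow (x * y) s = posPow x s * posPow y s := by
  rcases hx.eq_or_lt with rfl | hx'
  · simp [posPow]
  rcases hy.eq_or_lt with rfl | hy'
  · simp [posPow]
  · rw [posPow, posPow, posPow, if_pos hx', if_pos hy', if_pos (mul_pos hx' hy'),
      Real.mul_rpow hx hy]

lemma posPow_prod {n : ℕ} {x : Fin n → ℝ} (hx : ∀ k, 0 ≤ x k) (s : ℝ) :
    posPow (∏ k, x k) s = ∏ k, posPow (x k) s := by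
  induction n with
  | zero => simp [posPow]
  | succ n ih =>
    rw [Fin.prod_univ_succ, Fin.prod_univ_succ,
      posPow_mul (hx 0) (Finset.prod_nonneg fun k _ => hx _), ih fun k => hx _]

variable {d : Type*} [Fintype d] [DecidableEq d]

lemma norm_sq_tensorPow {d : Type*} (M : Matrix d d ℂ) (n : ℕ) (x y : Fin n → d) :
    ‖tensorPow M n x y‖ ^ 2 = ∏ k, ‖M (x k) (y k)‖ ^ 2 := by
  rw [tensorPow, of_apply, norm_prod, Finset.prod_pow]

/-- Chernoff sums are multiplicative under tensor powers. -/
lemma chernoffQ_iidSeq {A B : Matrix d d ℂ} (hA : A.PosSemidef) (hB : B.PosSemidef) {p q : ℝ}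
    (hp : 0 ≤ p) (hq : 0 ≤ q) (s : ℝ) (n : ℕ) :
    chernoffQ (iidSeq p A n) (iidSeq q B n) s =
      posPow p s * posPow q (1 - s) * chernoffQ A B s ^ n := by
  obtain ⟨U, hU, α, hα, rfl⟩ := exists_diagonalization hA
  obtain ⟨V, hV, β, hβ, rfl⟩ := exists_diagonalization hB
  rw [iidSeq_conj_diagonal, iidSeq_conj_diagonal,
    chernoffQ_conj_diagonal (tensorPow_mem_unitaryGroup hU n) (tensorPow_mem_unitaryGroup hV n),
    chernoffQ_conj_diagonal hU hV, ← sum_sum_prod_eq_pow, mul_sum]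
  refine sum_congr rfl fun x _ => ?_
  rw [mul_sum]
  refine sum_congr rfl fun y _ => ?_
  rw [← tensorPow_star, ← tensorPow_mul, norm_sq_tensorPow,
    posPow_mul hp (Finset.prod_nonneg fun k _ => hα _),
    posPow_mul hq (Finset.prod_nonneg fun k _ => hβ _),
    posPow_prod (fun k => hα _), posPow_prod (fun k => hβ _), Finset.prod_mul_distrib,
    Finset.prod_mul_distrib]
  ring

end IIDChernoff

/-! ### The classical Chernoff lower bound -/

section ClassicalChernoff

/-- The second moment of a sum of independent centred random variables. -/
lemma sum_prod_mul_sq_sum {Ω : Type*} [Fintype Ω] {R f : Ω → ℝ} (hR : ∑ ω, R ω = 1)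
    (hf : ∑ ω, R ω * f ω = 0) (n : ℕ) :
    ∑ x : Fin n → Ω, (∏ k, R (x k)) * (∑ k, f (x k)) ^ 2 = n * ∑ ω, R ω * f ω ^ 2 := by
  have h1 : ∀ n : ℕ, ∑ x : Fin n → Ω, (∏ k, R (x k)) = 1 := fun n => by
    rw [sum_prod_eq_sum_pow, hR, one_pow]
  induction n with
  | zero => simp
  | succ n ih =>
    have key : ∀ g : (Fin (n + 1) → Ω) → ℝ, ∑ x, g x = ∑ ω, ∑ x, g (Fin.cons ω x) := fun g => by
      rw [← (Fin.consEquiv fun _ => Ω).sum_comp, Fintype.sum_prod_type]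
      rfl
    rw [key]
    simp only [Fin.prod_univ_succ, Fin.sum_univ_succ, Fin.cons_zero, Fin.cons_succ]
    have expand : ∀ (ω : Ω) (x : Fin n → Ω), R ω * (∏ k, R (x k)) * (f ω + ∑ k, f (x k)) ^ 2 =
        (R ω * f ω ^ 2) * (∏ k, R (x k)) +
        (R ω * f ω) * (2 * ((∏ k, R (x k)) * ∑ k, f (x k))) +
        R ω * ((∏ k, R (x k)) * (∑ k, f (x k)) ^ 2) := fun ω x => by ring
    simp only [expand, sum_add_distrib, ← mul_sum, ← sum_mul, h1, ih, hf, hR]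
    push_cast
    ring

variable {Ω : Type*} [Fintype Ω]

/-- The minimiser of the Chernoff sum over `[0, 1]` satisfies a first-order condition: the mean of
the log-likelihood ratio under the tilted distribution is `0` in the interior and has the
appropriate sign at the end points. -/
lemma exists_chernoff_minimiser (α β w : Ω → ℝ) :
    ∃ s ∈ Set.Icc (0 : ℝ) 1,
      0 ≤ (1 - s) * ∑ ω, posPow (α ω) s * posPow (β ω) (1 - s) * w ω *
        (Real.log (α ω) - Real.log (β ω)) ∧
      0 ≤ -s * ∑ ω, posPow (α ω) s * posPow (β ω) (1 - s) * w ω *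
        (Real.log (α ω) - Real.log (β ω)) := by
  set g : ℝ → ℝ := fun s => ∑ ω, posPow (α ω) s * posPow (β ω) (1 - s) * w ω with hg
  have hderiv : ∀ s, HasDerivAt g (∑ ω, posPow (α ω) s * posPow (β ω) (1 - s) * w ω *
      (Real.log (α ω) - Real.log (β ω))) s := by
    intro s
    refine HasDerivAt.fun_sum fun ω _ => ?_
    by_cases hα : 0 < α ω
    · by_cases hβ : 0 < β ω
      · simp only [posPow, if_pos hα, if_pos hβ]
        have h1 : HasDerivAt (fun s : ℝ => α ω ^ s) (α ω ^ s * Real.log (α ω)) s :=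
          Real.hasStrictDerivAt_const_rpow hα s |>.hasDerivAt
        have h2 : HasDerivAt (fun s : ℝ => β ω ^ (1 - s)) (-(β ω ^ (1 - s) * Real.log (β ω))) s := by
          have h3 := (Real.hasStrictDerivAt_const_rpow hβ (1 - s)).hasDerivAt
          have h4 : HasDerivAt (fun s : ℝ => 1 - s) (-1) s := by
            simpa using (hasDerivAt_id s).const_sub 1
          exact (h3.comp s h4).congr_deriv (by ring)
        exact ((h1.mul h2).mul_const (w ω)).congr_deriv (by ring)
      · simpa [posPow, if_neg hβ] using hasDerivAt_const s (0 : ℝ)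
    · simpa [posPow, if_neg hα] using hasDerivAt_const s (0 : ℝ)
  obtain ⟨s, hs, hmin⟩ := isCompact_Icc.exists_isMinOn (Set.nonempty_Icc.mpr zero_le_one)
    (fun x _ => (hderiv x).continuousAt.continuousWithinAt : ContinuousOn g (Set.Icc 0 1))
  have hfirst : ∀ y ∈ Set.Icc (0 : ℝ) 1, 0 ≤ (y - s) * ∑ ω, posPow (α ω) s *
      posPow (β ω) (1 - s) * w ω * (Real.log (α ω) - Real.log (β ω)) := by
    intro y hy
    have h1 := hmin.localize.hasFDerivWithinAt_nonneg (hderiv s).hasFDerivAt.hasFDerivWithinAt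
      (sub_mem_posTangentConeAt_of_segment_subset ((convex_Icc (0 : ℝ) 1).segment_subset hs hy))
    simpa using h1
  refine ⟨s, hs, hfirst 1 (by simp), ?_⟩
  simpa using hfirst 0 (by simp)

/-- The converse part of Chernoff's theorem. With weights `α w` and `β w` on a finite set, the
optimal error of `n` independent observations is at least `exp (-n δ) / 2` times the `n`-th power of
a Chernoff sum, for large `n`. The proof changes measure to the distribution proportional to
`α ^ s β ^ (1 - s) w`, under which the log-likelihood ratio per observation concentrates around its
mean by Chebyshev's inequality; by the first-order condition on `s`, that mean does no harm. -/
theorem exists_classical_chernoff {α β w : Ω → ℝ} (hα : ∀ ω, 0 ≤ α ω) (hβ : ∀ ω, 0 ≤ β ω)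
    (hw : ∀ ω, 0 ≤ w ω) :
    ∃ s ∈ Set.Icc (0 : ℝ) 1, ∀ δ > 0, ∃ N : ℕ, ∀ n ≥ N,
      1 / 2 * (∑ ω, posPow (α ω) s * posPow (β ω) (1 - s) * w ω) ^ n * Real.exp (-(n * δ)) ≤
        ∑ x : Fin n → Ω, min (∏ k, α (x k)) (∏ k, β (x k)) * ∏ k, w (x k) := by
  obtain ⟨s, hs, hm1, hm2⟩ := exists_chernoff_minimiser α β w
  refine ⟨s, hs, fun δ hδ => ?_⟩
  set u : Ω → ℝ := fun ω => posPow (α ω) s * posPow (β ω) (1 - s) * w ω with hu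
  have hu0 : ∀ ω, 0 ≤ u ω := fun ω =>
    mul_nonneg (mul_nonneg (posPow_nonneg _ _) (posPow_nonneg _ _)) (hw ω)
  set z := ∑ ω, u ω with hz
  have hrhs : ∀ n : ℕ, 0 ≤ ∑ x : Fin n → Ω, min (∏ k, α (x k)) (∏ k, β (x k)) * ∏ k, w (x k) :=
    fun n => sum_nonneg fun x _ => mul_nonneg
      (le_min (prod_nonneg fun k _ => hα _) (prod_nonneg fun k _ => hβ _))
      (prod_nonneg fun k _ => hw _)
  have hz_nonneg : 0 ≤ z := sum_nonneg fun ω _ => hu0 ω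
  rcases hz_nonneg.eq_or_lt with hz0 | hzpos
  · refine ⟨1, fun n hn => ?_⟩
    rw [← hz0, zero_pow (by omega), mul_zero, zero_mul]
    exact hrhs n
  -- the tilted distribution and the log-likelihood ratio
  set R : Ω → ℝ := fun ω => u ω / z with hR
  have hR0 : ∀ ω, 0 ≤ R ω := fun ω => div_nonneg (hu0 ω) hzpos.le
  have hR1 : ∑ ω, R ω = 1 := by rw [hR, ← sum_div, div_self hzpos.ne']
  set l : Ω → ℝ := fun ω => Real.log (α ω) - Real.log (β ω) with hl
  set m := ∑ ω, R ω * l ω with hm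
  have hmz : m = (∑ ω, u ω * l ω) / z := by
    rw [hm, sum_div]
    exact sum_congr rfl fun ω _ => by rw [hR]; ring
  have hm1' : 0 ≤ (1 - s) * m := by
    rw [hmz, ← mul_div_assoc]
    exact div_nonneg hm1 hzpos.le
  have hm2' : 0 ≤ -s * m := by
    rw [hmz, ← mul_div_assoc]
    exact div_nonneg hm2 hzpos.le
  set v := ∑ ω, R ω * (l ω - m) ^ 2 with hv
  have hv0 : 0 ≤ v := sum_nonneg fun ω _ => mul_nonneg (hR0 ω) (sq_nonneg _)
  have hcent : ∑ ω, R ω * (l ω - m) = 0 := by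
    simp only [mul_sub, sum_sub_distrib, ← sum_mul, hR1, one_mul, ← hm, sub_self]
  obtain ⟨N, hN⟩ := exists_nat_gt (2 * v / δ ^ 2)
  refine ⟨N + 1, fun n hn => ?_⟩
  have hn0 : (0 : ℝ) < n := by exact_mod_cast (by omega : 0 < n)
  have hnN : (N : ℝ) ≤ n := by exact_mod_cast (by omega : N ≤ n)
  -- the pointwise change of measure
  have hpt : ∀ x : Fin n → Ω, z ^ n * Real.exp (-(n * δ)) *
      ((∏ k, R (x k)) - (∏ k, R (x k)) * (∑ k, (l (x k) - m)) ^ 2 / (n * δ) ^ 2) ≤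
      min (∏ k, α (x k)) (∏ k, β (x k)) * ∏ k, w (x k) := by
    intro x
    have hnn : 0 ≤ min (∏ k, α (x k)) (∏ k, β (x k)) * ∏ k, w (x k) := mul_nonneg
      (le_min (prod_nonneg fun k _ => hα _) (prod_nonneg fun k _ => hβ _))
      (prod_nonneg fun k _ => hw _)
    have hRn : 0 ≤ ∏ k, R (x k) := prod_nonneg fun k _ => hR0 _
    have hzn : 0 ≤ z ^ n * Real.exp (-(n * δ)) := by positivity
    have hfac : (∏ k, R (x k)) - (∏ k, R (x k)) * (∑ k, (l (x k) - m)) ^ 2 / (n * δ) ^ 2 =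
        (∏ k, R (x k)) * (1 - (∑ k, (l (x k) - m)) ^ 2 / (n * δ) ^ 2) := by ring
    rw [hfac]
    by_cases hpos : ∀ k, 0 < α (x k) ∧ 0 < β (x k)
    swap
    · obtain ⟨k, hk⟩ := not_forall.mp hpos
      have : R (x k) = 0 := by
        rw [not_and_or] at hk
        rcases hk with hk | hk <;> simp [hR, hu, posPow, hk]
      rw [prod_eq_zero (mem_univ k) this, zero_mul, mul_zero]
      exact hnn
    by_cases hdev : (∑ k, (l (x k) - m)) ^ 2 ≤ (n * δ) ^ 2
    swap
    · have h1 : 1 - (∑ k, (l (x k) - m)) ^ 2 / (n * δ) ^ 2 ≤ 0 := by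
        rw [sub_nonpos, one_le_div (by positivity)]
        exact (not_le.mp hdev).le
      exact (mul_nonpos_of_nonneg_of_nonpos hzn
        (mul_nonpos_of_nonneg_of_nonpos hRn h1)).trans hnn
    have habs := abs_le_of_sq_le_sq hdev (by positivity)
    have hsumL : ∑ k, (l (x k) - m) = (∑ k, l (x k)) - n * m := by
      rw [sum_sub_distrib]; simp
    rw [hsumL] at habs
    set L := ∑ k, l (x k) with hL
    have hle : (∏ k, R (x k)) * (1 - (∑ k, (l (x k) - m)) ^ 2 / (n * δ) ^ 2) ≤ ∏ k, R (x k) :=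
      mul_le_of_le_one_right hRn (sub_le_self _ (by positivity))
    refine (mul_le_mul_of_nonneg_left hle hzn).trans ?_
    have hzR : z ^ n * ∏ k, R (x k) = ∏ k, u (x k) := by
      rw [← Fin.prod_const, ← prod_mul_distrib]
      exact prod_congr rfl fun k _ => by rw [hR]; field_simp
    have hexpl : ∀ k, Real.exp (l (x k)) = α (x k) / β (x k) := fun k => by
      rw [hl, Real.exp_sub, Real.exp_log (hpos k).1, Real.exp_log (hpos k).2]
    have ea : (∏ k, u (x k)) * Real.exp ((1 - s) * L) = (∏ k, α (x k)) * ∏ k, w (x k) := by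
      rw [hL, mul_sum, Real.exp_sum, ← prod_mul_distrib, ← prod_mul_distrib]
      refine prod_congr rfl fun k _ => ?_
      obtain ⟨ha, hb⟩ := hpos k
      simp only [hu, posPow, if_pos ha, if_pos hb, hl]
      rw [Real.rpow_def_of_pos ha, Real.rpow_def_of_pos hb]
      conv_rhs => rw [← Real.exp_log ha]
      rw [mul_right_comm, mul_right_comm, ← Real.exp_add, mul_assoc, mul_comm (w _), ← mul_assoc,
        ← Real.exp_add]
      congr 2
      ring
    have eb : (∏ k, u (x k)) * Real.exp (-s * L) = (∏ k, β (x k)) * ∏ k, w (x k) := by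
      rw [hL, mul_sum, Real.exp_sum, ← prod_mul_distrib, ← prod_mul_distrib]
      refine prod_congr rfl fun k _ => ?_
      obtain ⟨ha, hb⟩ := hpos k
      simp only [hu, posPow, if_pos ha, if_pos hb, hl]
      rw [Real.rpow_def_of_pos ha, Real.rpow_def_of_pos hb]
      conv_rhs => rw [← Real.exp_log hb]
      rw [mul_right_comm, mul_right_comm, ← Real.exp_add, mul_assoc, mul_comm (w _), ← mul_assoc,
        ← Real.exp_add]
      congr 2
      ring
    have hu0' : 0 ≤ ∏ k, u (x k) := prod_nonneg fun k _ => hu0 _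
    rw [mul_right_comm, hzR, min_mul_of_nonneg _ _ (prod_nonneg fun k _ => hw _), ← ea, ← eb]
    obtain ⟨hlo, hhi⟩ := abs_le.mp habs
    have hnδ : 0 < n * δ := by positivity
    refine le_min ?_ ?_
    · refine mul_le_mul_of_nonneg_left (Real.exp_le_exp.mpr ?_) hu0'
      have h1 : (1 - s) * (-(n * δ)) ≤ (1 - s) * (L - n * m) :=
        mul_le_mul_of_nonneg_left hlo (by linarith [hs.2])
      have h2 : 0 ≤ n * ((1 - s) * m) := mul_nonneg hn0.le hm1'
      have h3 : 0 ≤ s * (n * δ) := mul_nonneg hs.1 hnδ.le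
      nlinarith
    · refine mul_le_mul_of_nonneg_left (Real.exp_le_exp.mpr ?_) hu0'
      have h1 : s * (L - n * m) ≤ s * (n * δ) := mul_le_mul_of_nonneg_left hhi hs.1
      have h2 : 0 ≤ n * (-s * m) := mul_nonneg hn0.le hm2'
      have h3 : 0 ≤ (1 - s) * (n * δ) := mul_nonneg (by linarith [hs.2]) hnδ.le
      nlinarith
  refine le_trans ?_ (sum_le_sum fun x _ => hpt x)
  rw [← mul_sum, sum_sub_distrib, ← sum_div, sum_prod_eq_sum_pow, hR1, one_pow,
    sum_prod_mul_sq_sum hR1 hcent n]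
  have hcheb : (n * ∑ ω, R ω * (l ω - m) ^ 2) / (n * δ) ^ 2 ≤ 1 / 2 := by
    rw [← hv, div_le_iff₀ (by positivity)]
    have h1 : 2 * v ≤ n * δ ^ 2 := by
      rw [div_lt_iff₀ (by positivity)] at hN
      nlinarith [sq_nonneg δ]
    nlinarith
  have hzn : 0 ≤ z ^ n * Real.exp (-(n * δ)) := by positivity
  nlinarith

end ClassicalChernoff

open ExpGrowth

/-! ### The bounds in terms of the sum of the pairwise errors -/

section SumOfPairs

lemma optError_pair_nonneg {ι d : Type*} [Fintype d] [DecidableEq d]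
    {A : ι → Matrix d d ℂ} (hA : ∀ i, (A i).PosSemidef) (i j : ι) :
    0 ≤ optError ![A i, A j] :=
  optError_nonneg (posSemidef_pair (hA i) (hA j))

variable {ι d : Type*} [Fintype ι] [DecidableEq ι] [Fintype d] [DecidableEq d]

/-- The sum of the optimal errors of all ordered pairs of distinct hypotheses. -/
noncomputable def pairErrorSum (A : ι → Matrix d d ℂ) : ℝ :=
  ∑ i, ∑ j ∈ univ.erase i, optError ![A i, A j]

lemma optError_pair_le_pairErrorSum {A : ι → Matrix d d ℂ} (hA : ∀ i, (A i).PosSemidef) {i j : ι}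
    (hij : i ≠ j) : optError ![A i, A j] ≤ pairErrorSum A :=
  (single_le_sum (f := fun j => optError ![A i, A j])
    (fun k _ => optError_pair_nonneg hA i k) (mem_erase.mpr ⟨hij.symm, mem_univ j⟩)).trans
  (single_le_sum (f := fun i => ∑ j ∈ univ.erase i, optError ![A i, A j])
    (fun k _ => sum_nonneg fun l _ => optError_pair_nonneg hA k l) (mem_univ i))

lemma pairErrorSum_nonneg {A : ι → Matrix d d ℂ} (hA : ∀ i, (A i).PosSemidef) :
    0 ≤ pairErrorSum A :=
  sum_nonneg fun k _ => sum_nonneg fun l _ => optError_pair_nonneg hA k l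

/-- A bound by a continuous function of `ε`, valid whenever all pairwise errors are below `ε`, holds
at `pairErrorSum`. -/
lemma le_of_forall_pair_lt {A : ι → Matrix d d ℂ} (hA : ∀ i, (A i).PosSemidef) {x : ℝ} {f : ℝ → ℝ}
    (hf : Continuous f)
    (h : ∀ ε > 0, (∀ i j, i ≠ j → optError ![A i, A j] < ε) → x ≤ f ε) :
    x ≤ f (pairErrorSum A) := by
  have hlim : Filter.Tendsto f (nhdsWithin (pairErrorSum A) (Set.Ioi (pairErrorSum A)))
      (nhds (f (pairErrorSum A))) := (hf.tendsto _).mono_left nhdsWithin_le_nhds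
  refine ge_of_tendsto hlim ?_
  filter_upwards [self_mem_nhdsWithin] with ε hε
  exact h ε ((pairErrorSum_nonneg hA).trans_lt hε) fun i j hij =>
    (optError_pair_le_pairErrorSum hA hij).trans_lt hε

theorem optError_le_sqrt {A : ι → Matrix d d ℂ} (hA : ∀ i, (A i).PosSemidef) :
    optError A ≤ 10 * (Fintype.card ι : ℝ) ^ 2 *
      √(pairErrorSum A * ((∑ i, A i).trace).re) :=
  le_of_forall_pair_lt hA (by fun_prop) fun _ hε h => optError_le_sqrt_of_lt hA hε h

theorem optError_le_mul {A : ι → Matrix d d ℂ} (hA : ∀ i, (A i).PosSemidef)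
    {S : Finset ι} (hS : Sᶜ.card ≤ 2) (hproj : ∀ i ∈ S, A i * A i = ((A i).trace).re • A i)
    (hpos : ∀ i, 0 < ((A i).trace).re) {κ : ℝ}
    (hκ : ∀ i j, ((A i).trace).re ≤ κ * ((A j).trace).re) :
    optError A ≤ 240 * (Fintype.card ι : ℝ) ^ 4 * (κ * pairErrorSum A) :=
  le_of_forall_pair_lt (f := fun ε => 240 * (Fintype.card ι : ℝ) ^ 4 * (κ * ε)) hA (by fun_prop)
    fun _ hε h => optError_le_mul_of_lt hA hS hproj hpos hκ hε h

lemma ofReal_pairErrorSum {A : ι → Matrix d d ℂ} (hA : ∀ i, (A i).PosSemidef) :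
    ENNReal.ofReal (pairErrorSum A) =
      ∑ i, ∑ j ∈ univ.erase i, ENNReal.ofReal (optError ![A i, A j]) := by
  rw [pairErrorSum, ENNReal.ofReal_sum_of_nonneg
    fun k _ => sum_nonneg fun l _ => optError_pair_nonneg hA k l]
  exact sum_congr rfl fun i _ =>
    ENNReal.ofReal_sum_of_nonneg fun j _ => optError_pair_nonneg hA i j

end SumOfPairs

/-! ### Exponents of sequences of hypotheses -/

section Exponents

lemma expGrowthSup_rpow {u : ℕ → ENNReal} {c : ℝ} (hc : 0 ≤ c) :
    expGrowthSup (fun n => u n ^ c) = (c : EReal) * expGrowthSup u := by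
  rw [expGrowthSup, expGrowthSup, ← EReal.limsup_const_mul_of_nonneg_of_ne_top
    (EReal.coe_nonneg.mpr hc) (EReal.coe_ne_top c)]
  refine Filter.limsup_congr (Filter.Eventually.of_forall fun n => ?_)
  rw [ENNReal.log_rpow, EReal.mul_div]

lemma iSup_le_neg_iInf {ι : Type*} {x y : ι → ι → EReal}
    (h : ∀ i j, i ≠ j → x i j ≤ -y i j) :
    ⨆ (i : ι) (j : ι) (_ : i ≠ j), x i j ≤ -⨅ (i : ι) (j : ι) (_ : i ≠ j), y i j :=
  iSup_le fun i => iSup_le fun j => iSup_le fun hij => (h i j hij).trans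
    (EReal.neg_le_neg_iff.mpr (iInf_le_of_le i (iInf_le_of_le j (iInf_le _ hij))))

lemma neg_iInf_le {ι : Type*} {x : EReal} {y : ι → ι → EReal}
    (h : ∀ i j, i ≠ j → -y i j ≤ x) :
    -⨅ (i : ι) (j : ι) (_ : i ≠ j), y i j ≤ x :=
  EReal.neg_le_of_neg_le (le_iInf fun i => le_iInf fun j => le_iInf fun hij =>
    EReal.neg_le_of_neg_le (h i j hij))

lemma half_mul_le_neg_half_mul {x y : EReal} (h : x ≤ -y) :
    ((1 / 2 : ℝ) : EReal) * x ≤ -(((1 / 2 : ℝ) : EReal) * y) := by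
  rw [← mul_neg]
  exact mul_le_mul_of_nonneg_left h (EReal.coe_nonneg.mpr (by norm_num))

variable {ι : Type*} [Fintype ι] {d : ℕ → Type*} [∀ n, Fintype (d n)] [∀ n, DecidableEq (d n)]

lemma expGrowthSup_pairErrorSum [DecidableEq ι] {A : ι → (n : ℕ) → Matrix (d n) (d n) ℂ}
    (hA : ∀ i n, (A i n).PosSemidef) :
    expGrowthSup (fun n => ENNReal.ofReal (pairErrorSum fun i => A i n)) =
      ⨆ (i : ι) (j : ι) (_ : i ≠ j), upperExponent ![A i, A j] := by
  have h1 : (fun n => ENNReal.ofReal (pairErrorSum fun i => A i n)) =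
      ∑ i, ∑ j ∈ univ.erase i, fun n => ENNReal.ofReal (optError ![A i n, A j n]) := by
    ext n
    rw [ofReal_pairErrorSum fun i => hA i n]
    simp only [Finset.sum_apply]
  rw [h1, expGrowthSup_sum]
  simp only [mem_univ, iSup_pos]
  refine iSup_congr fun i => ?_
  rw [expGrowthSup_sum]
  refine iSup_congr fun j => ?_
  simp only [mem_erase, mem_univ, and_true]
  have h2 : expGrowthSup (fun n => ENNReal.ofReal (optError ![A i n, A j n])) =
      upperExponent ![A i, A j] := by
    rw [upperExponent]
    congr 1
  rw [h2]
  exact iSup_congr_Prop ne_comm fun _ => rfl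

/-- The square-root bound turns into a factor `1 / 2` in the exponent. -/
theorem upperExponent_le_half {A : ι → (n : ℕ) → Matrix (d n) (d n) ℂ}
    (hA : ∀ i n, (A i n).PosSemidef)
    (htr : expGrowthSup (fun n => ENNReal.ofReal ((∑ i, A i n).trace).re) = 0) :
    upperExponent A ≤ ((1 / 2 : ℝ) : EReal) *
      ⨆ (i : ι) (j : ι) (_ : i ≠ j), upperExponent ![A i, A j] := by
  classical
  set M := fun n => ENNReal.ofReal (pairErrorSum fun i => A i n) with hM
  set t := fun n => ENNReal.ofReal ((∑ i, A i n).trace).re with ht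
  have h1 : ∀ n, ENNReal.ofReal (optError fun i => A i n) ≤
      ENNReal.ofReal (10 * (Fintype.card ι : ℝ) ^ 2) * (M * t) n ^ (1 / 2 : ℝ) := by
    intro n
    have h2 := optError_le_sqrt fun i => hA i n
    have hp := pairErrorSum_nonneg fun i => hA i n
    have htn : 0 ≤ ((∑ i, A i n).trace).re :=
      trace_re_nonneg (Matrix.posSemidef_sum _ fun i _ => hA i n)
    rw [Pi.mul_apply, hM, ht, ← ENNReal.ofReal_mul hp,
      ENNReal.ofReal_rpow_of_nonneg (mul_nonneg hp htn) (by norm_num),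
      ← ENNReal.ofReal_mul (by positivity), ← Real.sqrt_eq_rpow]
    exact ENNReal.ofReal_le_ofReal h2
  refine (expGrowthSup_le_of_eventually_le ENNReal.ofReal_ne_top
    (Filter.Eventually.of_forall h1)).trans ?_
  rw [expGrowthSup_rpow (by norm_num), ← expGrowthSup_pairErrorSum hA]
  refine mul_le_mul_of_nonneg_left ?_ (EReal.coe_nonneg.mpr (by norm_num))
  have h3 := expGrowthSup_mul_le (u := M) (v := t) (Or.inr (by rw [htr]; exact EReal.zero_ne_top))
    (Or.inr (by rw [htr]; exact EReal.zero_ne_bot))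
  rwa [htr, add_zero] at h3

/-- If all but two hypotheses are multiples of projections, no factor `1 / 2` is lost. -/
theorem upperExponent_le_of_proj [Nonempty ι] [DecidableEq ι]
    {A : ι → (n : ℕ) → Matrix (d n) (d n) ℂ}
    (hA : ∀ i n, (A i n).PosSemidef) (hpos : ∀ i n, 0 < ((A i n).trace).re)
    {S : Finset ι} (hS : Sᶜ.card ≤ 2)
    (hproj : ∀ i ∈ S, ∀ n, A i n * A i n = ((A i n).trace).re • A i n)
    (htr : expGrowthSup (fun n => ENNReal.ofReal
      (((∑ i, A i n).trace).re / (⨅ i, ((A i n).trace).re))) = 0) :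
    upperExponent A ≤ ⨆ (i : ι) (j : ι) (_ : i ≠ j), upperExponent ![A i, A j] := by
  set M := fun n => ENNReal.ofReal (pairErrorSum fun i => A i n) with hM
  set κ := fun n => ENNReal.ofReal (((∑ i, A i n).trace).re / (⨅ i, ((A i n).trace).re)) with hκ
  have h1 : ∀ n, ENNReal.ofReal (optError fun i => A i n) ≤
      ENNReal.ofReal (240 * (Fintype.card ι : ℝ) ^ 4) * (κ * M) n := by
    intro n
    have htn : 0 ≤ ((∑ i, A i n).trace).re :=
      trace_re_nonneg (Matrix.posSemidef_sum _ fun i _ => hA i n)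
    have hinf : 0 < ⨅ i, ((A i n).trace).re := by
      obtain ⟨i, hi⟩ := exists_eq_ciInf_of_finite (f := fun i => ((A i n).trace).re)
      rw [← hi]
      exact hpos i n
    have hquot : 0 ≤ ((∑ i, A i n).trace).re / (⨅ i, ((A i n).trace).re) :=
      div_nonneg htn hinf.le
    have h2 := optError_le_mul (κ := ((∑ i, A i n).trace).re / (⨅ i, ((A i n).trace).re))
      (fun i => hA i n) hS (fun i hi => hproj i hi n) (fun i => hpos i n) (fun i j => by
        have hj : ⨅ i, ((A i n).trace).re ≤ ((A j n).trace).re :=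
          ciInf_le (Set.finite_range _).bddBelow j
        calc ((A i n).trace).re ≤ ((∑ i, A i n).trace).re := trace_le_trace_sum (fun i => hA i n) i
          _ = ((∑ i, A i n).trace).re / (⨅ i, ((A i n).trace).re) * ⨅ i, ((A i n).trace).re := by
              rw [div_mul_cancel₀ _ hinf.ne']
          _ ≤ _ := mul_le_mul_of_nonneg_left hj hquot)
    rw [Pi.mul_apply, hM, hκ, ← ENNReal.ofReal_mul hquot, ← ENNReal.ofReal_mul (by positivity)]
    exact ENNReal.ofReal_le_ofReal h2
  refine (expGrowthSup_le_of_eventually_le ENNReal.ofReal_ne_top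
    (Filter.Eventually.of_forall h1)).trans ?_
  rw [← expGrowthSup_pairErrorSum hA]
  have h3 := expGrowthSup_mul_le (u := κ) (v := M) (Or.inl (by rw [htr]; exact EReal.zero_ne_bot))
    (Or.inl (by rw [htr]; exact EReal.zero_ne_top))
  rwa [htr, zero_add] at h3

lemma upperExponent_pair_le {A B : (n : ℕ) → Matrix (d n) (d n) ℂ}
    (hA : ∀ n, (A n).PosSemidef) (hB : ∀ n, (B n).PosSemidef) :
    upperExponent ![A, B] ≤ -regChernoffDiv A B := by
  rw [regChernoffDiv, neg_neg, upperExponent]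
  refine expGrowthSup_monotone fun n => ENNReal.ofReal_le_ofReal ?_
  have h1 : (fun i => ![A, B] i n) = ![A n, B n] := by
    ext k
    fin_cases k <;> rfl
  rw [h1]
  exact optError_pair_le_chernoffQMin (hA n) (hB n)

end Exponents

/-! ### Exponents of i.i.d. hypotheses -/

section IID

variable {ι d : Type*} [Fintype ι] [Fintype d] [DecidableEq d]

/-- Tensor powers attain at least the single-letter Chernoff divergence. -/
theorem chernoffDiv_le_regChernoffDiv {A B : Matrix d d ℂ} (hA : A.PosSemidef)
    (hB : B.PosSemidef) {p q : ℝ} (hp : 0 ≤ p) (hq : 0 ≤ q) :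
    chernoffDiv A B ≤ regChernoffDiv (iidSeq p A) (iidSeq q B) := by
  rw [chernoffDiv, regChernoffDiv, EReal.neg_le_neg_iff]
  set g := expGrowthSup fun n => ENNReal.ofReal (chernoffQMin (iidSeq p A n) (iidSeq q B n))
    with hg
  have hs : ∀ s ∈ Set.Icc (0 : ℝ) 1, EReal.exp g ≤ ENNReal.ofReal (chernoffQ A B s) := by
    intro s hs
    rw [← ENNReal.exp_log (ENNReal.ofReal (chernoffQ A B s)), EReal.exp_le_exp_iff,
      ← expGrowthSup_pow]
    refine expGrowthSup_le_of_eventually_le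
      (b := ENNReal.ofReal (posPow p s * posPow q (1 - s))) ENNReal.ofReal_ne_top
      (Filter.Eventually.of_forall fun n => ?_)
    rw [← ENNReal.ofReal_pow (chernoffQ_nonneg A B s),
      ← ENNReal.ofReal_mul (mul_nonneg (posPow_nonneg _ _) (posPow_nonneg _ _)),
      ← chernoffQ_iidSeq hA hB hp hq]
    exact ENNReal.ofReal_le_ofReal (chernoffQMin_le _ _ hs)
  have htop : EReal.exp g ≠ ⊤ := ((hs 0 (by simp)).trans_lt ENNReal.ofReal_lt_top).ne
  rw [← EReal.log_exp g]
  refine ENNReal.log_monotone ?_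
  rw [← ENNReal.ofReal_toReal htop]
  refine ENNReal.ofReal_le_ofReal (le_csInf ⟨_, 0, by simp, rfl⟩ ?_)
  rintro _ ⟨s, hs', rfl⟩
  exact ENNReal.toReal_le_of_le_ofReal (chernoffQ_nonneg A B s) (hs s hs')

/-- The comparison with a classical problem in eigenbases of the two states, combined with
Chernoff's classical lower bound, bounds the error of i.i.d. binary discrimination below. -/
theorem exists_le_optError_iidSeq {A B : Matrix d d ℂ} (hA : A.PosSemidef) (hB : B.PosSemidef)
    {p q : ℝ} (hp : 0 < p) (hq : 0 < q) :
    ∃ s ∈ Set.Icc (0 : ℝ) 1, ∀ δ > 0, ∃ N : ℕ, ∀ n ≥ N,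
      1 / 4 * min p q * (chernoffQ A B s * Real.exp (-δ)) ^ n ≤
        optError ![iidSeq p A n, iidSeq q B n] := by
  obtain ⟨U, hU, α, hα, rfl⟩ := exists_diagonalization hA
  obtain ⟨V, hV, β, hβ, rfl⟩ := exists_diagonalization hB
  obtain ⟨s, hs, h⟩ := exists_classical_chernoff (Ω := d × d) (α := fun ω => α ω.1)
    (β := fun ω => β ω.2) (w := fun ω => ‖(star U * V) ω.1 ω.2‖ ^ 2) (fun ω => hα _)
    (fun ω => hβ _) (fun ω => by positivity)
  refine ⟨s, hs, fun δ hδ => ?_⟩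
  obtain ⟨N, hN⟩ := h δ hδ
  refine ⟨N, fun n hn => ?_⟩
  have h1 := hN n hn
  rw [Fintype.sum_prod_type, ← chernoffQ_conj_diagonal hU hV] at h1
  set Q := chernoffQ (U * diagonal (fun i => (α i : ℂ)) * star U)
    (V * diagonal (fun i => (β i : ℂ)) * star V) s
  rw [iidSeq_conj_diagonal, iidSeq_conj_diagonal]
  refine le_trans ?_ (half_sum_min_le_optError (tensorPow_mem_unitaryGroup hU n)
    (tensorPow_mem_unitaryGroup hV n)
    (fun x => mul_nonneg hp.le (Finset.prod_nonneg fun k _ => hα _))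
    (fun x => mul_nonneg hq.le (Finset.prod_nonneg fun k _ => hβ _)))
  have hsum : ∑ x : Fin n → d × d, min (∏ k, α (x k).1) (∏ k, β (x k).2) *
        ∏ k, ‖(star U * V) (x k).1 (x k).2‖ ^ 2 =
      ∑ x : Fin n → d, ∑ y : Fin n → d, min (∏ k, α (x k)) (∏ k, β (y k)) *
        ∏ k, ‖(star U * V) (x k) (y k)‖ ^ 2 := by
    rw [← Fintype.sum_prod_type']
    exact (Equiv.arrowProdEquivProdArrow (Fin n) (fun _ => d) (fun _ => d)).sum_comp
      (fun z => min (∏ k, α (z.1 k)) (∏ k, β (z.2 k)) * ∏ k, ‖(star U * V) (z.1 k) (z.2 k)‖ ^ 2)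
  rw [hsum] at h1
  have hmin : 0 ≤ min p q := (lt_min hp hq).le
  calc 1 / 4 * min p q * (Q * Real.exp (-δ)) ^ n
      = 1 / 2 * (min p q * (1 / 2 * Q ^ n * Real.exp (-(n * δ)))) := by
        rw [mul_pow, ← Real.exp_nat_mul]
        ring_nf
    _ ≤ 1 / 2 * (min p q * ∑ x : Fin n → d, ∑ y : Fin n → d,
          min (∏ k, α (x k)) (∏ k, β (y k)) * ∏ k, ‖(star U * V) (x k) (y k)‖ ^ 2) := by
        gcongr
    _ ≤ _ := by
        refine mul_le_mul_of_nonneg_left ?_ (by norm_num)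
        rw [mul_sum]
        refine sum_le_sum fun x _ => ?_
        rw [mul_sum]
        refine sum_le_sum fun y _ => ?_
        rw [← tensorPow_star, ← tensorPow_mul, norm_sq_tensorPow, ← mul_assoc]
        refine mul_le_mul_of_nonneg_right ?_ (Finset.prod_nonneg fun k _ => by positivity)
        have hαβ : 0 ≤ min (∏ k, α (x k)) (∏ k, β (y k)) :=
          le_min (Finset.prod_nonneg fun k _ => hα _) (Finset.prod_nonneg fun k _ => hβ _)
        exact le_min (mul_le_mul (min_le_left _ _) (min_le_left _ _) hαβ hp.le)
          (mul_le_mul (min_le_right _ _) (min_le_right _ _) hαβ hq.le)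

/-- Converse of the Chernoff bound: no pair can be discriminated faster than its divergence. -/
theorem neg_chernoffDiv_le_lowerExponent {p : ι → ℝ} {σ : ι → Matrix d d ℂ} (hp : ∀ i, 0 < p i)
    (hσ : ∀ i, (σ i).PosSemidef) {i j : ι} (hij : i ≠ j) :
    -chernoffDiv (σ i) (σ j) ≤ lowerExponent (fun i n => iidSeq (p i) (σ i) n) := by
  rw [chernoffDiv, neg_neg]
  obtain ⟨s, hs, h⟩ := exists_le_optError_iidSeq (hσ i) (hσ j) (hp i) (hp j)
  have hδ : ∀ δ > 0, ENNReal.ofReal (chernoffQ (σ i) (σ j) s * Real.exp (-δ)) ≤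
      EReal.exp (lowerExponent (fun i n => iidSeq (p i) (σ i) n)) := by
    intro δ hδ
    obtain ⟨N, hN⟩ := h δ hδ
    rw [← ENNReal.exp_log (ENNReal.ofReal _), EReal.exp_le_exp_iff, ← expGrowthInf_pow]
    have hmin : 0 < min (p i) (p j) := lt_min (hp i) (hp j)
    refine expGrowthInf_of_eventually_ge (b := ENNReal.ofReal (1 / 4 * min (p i) (p j)))
      (by rw [ne_eq, ENNReal.ofReal_eq_zero, not_le]; positivity) ?_
    filter_upwards [Filter.eventually_ge_atTop N] with n hn
    rw [← ENNReal.ofReal_pow (mul_nonneg (chernoffQ_nonneg _ _ s) (Real.exp_pos _).le),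
      ← ENNReal.ofReal_mul (by positivity)]
    exact ENNReal.ofReal_le_ofReal ((hN n hn).trans (optError_pair_le_optError
      (A := fun i => iidSeq (p i) (σ i) n) (fun i => posSemidef_iidSeq (hp i).le (hσ i) n) hij))
  have hlim : Filter.Tendsto
      (fun δ : ℝ => ENNReal.ofReal (chernoffQ (σ i) (σ j) s * Real.exp (-δ)))
      (nhdsWithin 0 (Set.Ioi 0)) (nhds (ENNReal.ofReal (chernoffQ (σ i) (σ j) s))) := by
    have hc : Continuous fun δ : ℝ => ENNReal.ofReal (chernoffQ (σ i) (σ j) s * Real.exp (-δ)) :=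
      ENNReal.continuous_ofReal.comp (by fun_prop)
    have := hc.tendsto 0
    rw [neg_zero, Real.exp_zero, mul_one] at this
    exact this.mono_left nhdsWithin_le_nhds
  have hle := le_of_tendsto hlim (by filter_upwards [self_mem_nhdsWithin] with δ hδ' using hδ δ hδ')
  rw [← EReal.log_exp (lowerExponent _)]
  exact ENNReal.log_monotone
    ((ENNReal.ofReal_le_ofReal (chernoffQMin_le _ _ hs)).trans hle)

end IID

/-! ### Traces and exponents of i.i.d. families -/

lemma card_compl_le_two {r : ℕ} {S : Finset (Fin r)} (hS : r - 2 ≤ S.card) : Sᶜ.card ≤ 2 := by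
  rw [card_compl, Fintype.card_fin]
  omega

lemma upperExponent_iidSeq_pair_le {d : Type*} [Fintype d] [DecidableEq d] {p q : ℝ} (hp : 0 ≤ p)
    (hq : 0 ≤ q) {σ τ : Matrix d d ℂ} (hσ : σ.PosSemidef) (hτ : τ.PosSemidef) :
    upperExponent ![iidSeq p σ, iidSeq q τ] ≤ -chernoffDiv σ τ :=
  (upperExponent_pair_le (posSemidef_iidSeq hp hσ) (posSemidef_iidSeq hq hτ)).trans
    (EReal.neg_le_neg_iff.mpr (chernoffDiv_le_regChernoffDiv hσ hτ hp hq))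

lemma re_trace_sum_iidSeq {ι d : Type*} [Fintype ι] [Fintype d] {p : ι → ℝ} {σ : ι → Matrix d d ℂ}
    (hσ : ∀ i, IsState (σ i)) (n : ℕ) :
    ((∑ i, iidSeq (p i) (σ i) n).trace).re = ∑ i, p i := by
  rw [Matrix.trace_sum, Complex.re_sum]
  exact sum_congr rfl fun i _ => trace_iidSeq (p i) (hσ i).2 n

lemma expGrowthSup_const_ofReal {x : ℝ} (hx : 0 < x) :
    expGrowthSup (fun _ => ENNReal.ofReal x) = 0 :=
  expGrowthSup_const (by simpa using hx) ENNReal.ofReal_ne_top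

end StateDiscrimination

open StateDiscrimination

theorem mainTheorem1 (r : ℕ) (hr : 2 ≤ r) :
    -- arbitrary sequences of non-zero positive semidefinite operators
    (∀ (d : ℕ → Type*) [∀ n, Fintype (d n)] [∀ n, DecidableEq (d n)]
        (A : Fin r → (n : ℕ) → Matrix (d n) (d n) ℂ),
        (∀ i n, (A i n).PosSemidef) → (∀ i n, A i n ≠ 0) →
        ExpGrowth.expGrowthSup (fun n => ENNReal.ofReal ((∑ i, A i n).trace).re) = 0 →
        (StateDiscrimination.upperExponent A ≤
            ((1 / 2 : ℝ) : EReal) *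
              (⨆ (i : Fin r) (j : Fin r) (_ : i ≠ j),
                StateDiscrimination.upperExponent ![A i, A j]) ∧
          ((1 / 2 : ℝ) : EReal) *
              (⨆ (i : Fin r) (j : Fin r) (_ : i ≠ j),
                StateDiscrimination.upperExponent ![A i, A j]) ≤
            -(((1 / 2 : ℝ) : EReal) *
              (⨅ (i : Fin r) (j : Fin r) (_ : i ≠ j),
                StateDiscrimination.regChernoffDiv (A i) (A j)))) ∧
        ((∃ S : Finset (Fin r), r - 2 ≤ S.card ∧ ∀ i ∈ S, ∀ n, (A i n).rank = 1) →
          ExpGrowth.expGrowthSup (fun n => ENNReal.ofReal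
            (((∑ i, A i n).trace).re / (⨅ i, ((A i n).trace).re))) = 0 →
          StateDiscrimination.upperExponent A ≤
              (⨆ (i : Fin r) (j : Fin r) (_ : i ≠ j),
                StateDiscrimination.upperExponent ![A i, A j]) ∧
            (⨆ (i : Fin r) (j : Fin r) (_ : i ≠ j),
                StateDiscrimination.upperExponent ![A i, A j]) ≤
              -(⨅ (i : Fin r) (j : Fin r) (_ : i ≠ j),
                StateDiscrimination.regChernoffDiv (A i) (A j)))) ∧
    -- the i.i.d. case
    (∀ (d : Type*) [Fintype d] [DecidableEq d] (p : Fin r → ℝ) (σ : Fin r → Matrix d d ℂ),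
        (∀ i, 0 < p i) → (∀ i, StateDiscrimination.IsState (σ i)) →
        (-(⨅ (i : Fin r) (j : Fin r) (_ : i ≠ j),
              StateDiscrimination.chernoffDiv (σ i) (σ j)) ≤
            StateDiscrimination.lowerExponent
              (fun i n => StateDiscrimination.iidSeq (p i) (σ i) n) ∧
          StateDiscrimination.lowerExponent
              (fun i n => StateDiscrimination.iidSeq (p i) (σ i) n) ≤
            StateDiscrimination.upperExponent
              (fun i n => StateDiscrimination.iidSeq (p i) (σ i) n) ∧
          StateDiscrimination.upperExponent
              (fun i n => StateDiscrimination.iidSeq (p i) (σ i) n) ≤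
            -(((1 / 2 : ℝ) : EReal) *
              (⨅ (i : Fin r) (j : Fin r) (_ : i ≠ j),
                StateDiscrimination.chernoffDiv (σ i) (σ j)))) ∧
        ((∃ S : Finset (Fin r), r - 2 ≤ S.card ∧ ∀ i ∈ S, (σ i).rank = 1) →
          StateDiscrimination.lowerExponent
              (fun i n => StateDiscrimination.iidSeq (p i) (σ i) n) =
            -(⨅ (i : Fin r) (j : Fin r) (_ : i ≠ j),
              StateDiscrimination.chernoffDiv (σ i) (σ j)) ∧
          StateDiscrimination.upperExponent
              (fun i n => StateDiscrimination.iidSeq (p i) (σ i) n) =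
            -(⨅ (i : Fin r) (j : Fin r) (_ : i ≠ j),
              StateDiscrimination.chernoffDiv (σ i) (σ j)))) := by
  have : Nonempty (Fin r) := ⟨⟨0, by omega⟩⟩
  refine ⟨?_, ?_⟩
  · intro d _ _ A hA hA0 htr
    have hpair : ⨆ (i : Fin r) (j : Fin r) (_ : i ≠ j), upperExponent ![A i, A j] ≤
        -⨅ (i : Fin r) (j : Fin r) (_ : i ≠ j), regChernoffDiv (A i) (A j) :=
      iSup_le_neg_iInf fun i j _ => upperExponent_pair_le (hA i) (hA j)
    refine ⟨⟨upperExponent_le_half hA htr, half_mul_le_neg_half_mul hpair⟩, ?_⟩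
    rintro ⟨S, hS, hrank⟩ hκ
    exact ⟨upperExponent_le_of_proj hA (fun i n => trace_re_pos (hA i n) (hA0 i n))
      (card_compl_le_two hS)
      (fun i hi n => mul_self_eq_trace_smul_of_rank_eq_one (hA i n) (hrank i hi n)) hκ, hpair⟩
  · intro d _ _ p σ hp hσ
    set A : Fin r → (n : ℕ) → Matrix (Fin n → d) (Fin n → d) ℂ :=
      fun i n => iidSeq (p i) (σ i) n with hAdef
    have hA : ∀ i n, (A i n).PosSemidef := fun i n => posSemidef_iidSeq (hp i).le (hσ i).1 n
    have htrA : ∀ i n, ((A i n).trace).re = p i := fun i n => trace_iidSeq (p i) (hσ i).2 n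
    have hsum : 0 < ∑ i, p i := Finset.sum_pos (fun i _ => hp i) Finset.univ_nonempty
    have htr : ExpGrowth.expGrowthSup (fun n => ENNReal.ofReal ((∑ i, A i n).trace).re) = 0 := by
      simp only [hAdef, re_trace_sum_iidSeq hσ]
      exact expGrowthSup_const_ofReal hsum
    have hlow : -⨅ (i : Fin r) (j : Fin r) (_ : i ≠ j), chernoffDiv (σ i) (σ j) ≤
        lowerExponent A :=
      neg_iInf_le fun i j hij => neg_chernoffDiv_le_lowerExponent hp (fun i => (hσ i).1) hij
    have hmid : lowerExponent A ≤ upperExponent A := ExpGrowth.expGrowthInf_le_expGrowthSup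
    have hpair : ⨆ (i : Fin r) (j : Fin r) (_ : i ≠ j), upperExponent ![A i, A j] ≤
        -⨅ (i : Fin r) (j : Fin r) (_ : i ≠ j), chernoffDiv (σ i) (σ j) :=
      iSup_le_neg_iInf fun i j _ =>
        upperExponent_iidSeq_pair_le (hp i).le (hp j).le (hσ i).1 (hσ j).1
    refine ⟨⟨hlow, hmid, (upperExponent_le_half hA htr).trans (half_mul_le_neg_half_mul hpair)⟩, ?_⟩
    rintro ⟨S, hS, hrank⟩
    have hκ : ExpGrowth.expGrowthSup (fun n => ENNReal.ofReal
        (((∑ i, A i n).trace).re / (⨅ i, ((A i n).trace).re))) = 0 := by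
      simp only [htrA]
      simp only [hAdef, re_trace_sum_iidSeq hσ]
      refine expGrowthSup_const_ofReal (div_pos hsum ?_)
      obtain ⟨i, hi⟩ := exists_eq_ciInf_of_finite (f := p)
      rw [← hi]
      exact hp i
    have hup : upperExponent A ≤
        -⨅ (i : Fin r) (j : Fin r) (_ : i ≠ j), chernoffDiv (σ i) (σ j) := by
      refine (upperExponent_le_of_proj hA (fun i n => (htrA i n).symm ▸ hp i)
        (card_compl_le_two hS) (fun i hi n => ?_) hκ).trans hpair
      rw [htrA]
      refine iidSeq_mul_self (p i) ?_ n
      rw [mul_self_eq_trace_smul_of_rank_eq_one (hσ i).1 (hrank i hi), (hσ i).2]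
      simp
    exact ⟨le_antisymm (hmid.trans hup) hlow, le_antisymm hup (hlow.trans hmid)⟩
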